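/- Suppose $\mathcal A$ is a unital separable approximately divisible C$^*$-algebra generated (as a unital C$^*$-algebra) by self-adjoint elements $x_1,\ldots,x_n$. Then $$\delta_{top}(x_1,\ldots,x_n)\le 1 .$$ Here the notions are as follows. A finite-dimensional C$^*$-algebra $\mathcal B\cong \mathcal M_{k_1}(\mathbb C)\oplus\cdots\oplus\mathcal M_{k_r}(\mathbb C)$ (with $r,k_1,\ldots,k_r$ positive integers) has subrank $\mathrm{SubRank}(\mathcal B)=\min\{k_1,\ldots,k_r\}$. A separable unital C$^*$-algebra $\mathcal A$ is approximately divisible if for all $y_1,\ldots,y_l\in\mathcal A$ and $\varepsilon>0$ there is a finite-dimensional C$^*$-subalgebra $\mathcal B\subseteq\mathcal A$ containing the unit of $\mathcal A$ with $\mathrm{SubRank}(\mathcal B)\ge 2$ and $\|y_iy-yy_i\|<\varepsilon$ for all $i$ and all $y\in\mathcal B$ with $\|y\|\le 1$. Let $p_1,p_2,\ldots$ be any enumeration of the set of all noncommutative polynomials in $\mathbb C\langle X_1,\ldots,X_n\rangle$ whose coefficients lie in $\mathbb Q+i\mathbb Q$. For positive integers $k,m$ and $\varepsilon>0$, let $\Gamma_{top}(x_1,\ldots,x_n;k,\varepsilon,m)$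 be the set of all $n$-tuples $(A_1,\ldots,A_n)$ of self-adjoint matrices in $\mathcal M_k(\mathbb C)$ with $$\bigl|\,\|p_j(A_1,\ldots,A_n)\|-\|p_j(x_1,\ldots,x_n)\|\,\bigr|<\varepsilon\qquad(1\le j\le m),$$ where matrices carry the operator norm. For a subset $\mathcal F\subseteq\mathcal M_k(\mathbb C)^n$ and $\omega>0$, let $\nu_\infty(\mathcal F,\omega)\in\{0,1,2,\ldots,\infty\}$ be the minimal number of open balls of radius $\omega$, for the norm $\|(A_1,\ldots,A_n)\|=\max_i\|A_i\|$ on $\mathcal M_k(\mathbb C)^n$, whose union covers $\mathcal F$. With $\log 0=-\infty$ and $\log\infty=\infty$, put $$\delta_{top}(x_1,\ldots,x_n;\omega)=\inf_{\varepsilon>0,\;m\in\mathbb N}\ \limsup_{k\to\infty}\frac{\log \nu_\infty(\Gamma_{top}(x_1,\ldots,x_n;k,\varepsilon,m),\omega)}{-k^2\log\omega},\qquad \delta_{top}(x_1,\ldots,x_n)=\limsup_{\omega\to0^+}\delta_{top}(x_1,\ldots,x_n;\omega)\in[-\infty,\infty].$$ -/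

import Mathlib

open Filter Topology

noncomputable section

namespace TopFreeEntropy

/-! ### Finite-dimensional C*-subalgebras and approximate divisibility -/

/-- The subrank `min {k₁, …, kᵣ}` of a finite-dimensional C*-algebra
`B ≅ M_{k₁}(ℂ) ⊕ ⋯ ⊕ M_{kᵣ}(ℂ)` with `r, k₁, …, kᵣ` positive. The multiset of the sizes `kᵢ` is
determined by `B`, so the set below is `{k₁, …, kᵣ}`. (It is empty, and the value is the default
`0`, if `B` is the zero algebra or is not finite-dimensional.) -/
def subRank {A : Type*} [CStarAlgebra A] (B : StarSubalgebra ℂ A) : ℕ :=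
  sInf {d : ℕ | ∃ (r : ℕ) (k : Fin r → ℕ), (∀ i, 0 < k i) ∧
    Nonempty (B ≃⋆ₐ[ℂ] (∀ i : Fin r, Matrix (Fin (k i)) (Fin (k i)) ℂ)) ∧ ∃ i, k i = d}

/-- Approximate divisibility of a unital C*-algebra (a `StarSubalgebra` contains the unit of `A`,
and it is closed as soon as it is finite-dimensional). -/
def IsApproximatelyDivisible (A : Type*) [CStarAlgebra A] : Prop :=
  ∀ (n : ℕ) (x : Fin n → A) (ε : ℝ), 0 < ε →
    ∃ B : StarSubalgebra ℂ A, FiniteDimensional ℂ B ∧ 2 ≤ subRank B ∧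
      ∀ i : Fin n, ∀ y ∈ B, ‖y‖ ≤ 1 → ‖x i * y - y * x i‖ < ε

/-- The unital C*-algebra `A` is generated by the elements `x₁, …, xₙ`. -/
def Generates {A : Type*} [CStarAlgebra A] {n : ℕ} (x : Fin n → A) : Prop :=
  (StarAlgebra.adjoin ℂ (Set.range x)).topologicalClosure = ⊤

/-! ### Noncommutative polynomials with rational complex coefficients -/

/-- The noncommutative polynomial `q ∈ ℂ⟨X₁, …, Xₙ⟩` has rational complex coefficients: for every
word `w` in the indeterminates, the coefficient of `w` in `q` lies in `ℚ + iℚ`. -/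
def HasRationalCoeffs {n : ℕ} (q : FreeAlgebra ℂ (Fin n)) : Prop :=
  ∀ w : FreeMonoid (Fin n), ∃ a b : ℚ,
    (FreeAlgebra.equivMonoidAlgebraFreeMonoid q).coeff w = (a : ℂ) + (b : ℂ) * Complex.I

/-- The sequence `p₀, p₁, p₂, …` enumerates the set of all noncommutative polynomials in
`ℂ⟨X₁, …, Xₙ⟩` with rational complex coefficients. -/
def IsRationalEnumeration {n : ℕ} (p : ℕ → FreeAlgebra ℂ (Fin n)) : Prop :=
  Set.range p = {q | HasRationalCoeffs q}

/-- The value `q(x₁, …, xₙ)` of a noncommutative polynomial. -/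
def evalPoly {n : ℕ} {R : Type*} [Ring R] [Algebra ℂ R] (q : FreeAlgebra ℂ (Fin n))
    (x : Fin n → R) : R :=
  FreeAlgebra.lift ℂ x q

/-! ### Covering numbers -/

/-- The minimal number of open balls of radius `ω` in `X` whose union covers `F` (`⊤` if no finite
number of balls suffices). -/
def coveringNumber {X : Type*} [PseudoMetricSpace X] (F : Set X) (ω : ℝ) : ℕ∞ :=
  ⨅ (C : Set X) (_ : F ⊆ ⋃ c ∈ C, Metric.ball c ω), C.encard

/-! ### Matricial microstates and topological free entropy dimension -/

section Microstates

/- Matrices carry the operator norm of `ℂᵏ` with its Euclidean norm, and an `n`-tuple of matrices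
(a function on `Fin n`) carries the maximum of the norms of its entries. -/
open scoped Matrix.Norms.L2Operator

variable {A : Type*} [CStarAlgebra A] {n : ℕ}

/-- The microstates `Γ_top(x₁, …, xₙ; k, ε, m)`: the `n`-tuples of self-adjoint `k × k` matrices
such that the norms of the values of the first `m` polynomials of the sequence `p` agree with those
at `(x₁, …, xₙ)` up to less than `ε`. -/
def gammaTop (p : ℕ → FreeAlgebra ℂ (Fin n)) (x : Fin n → A) (k : ℕ) (ε : ℝ) (m : ℕ) :
    Set (Fin n → Matrix (Fin k) (Fin k) ℂ) :=
  {a | (∀ i, IsSelfAdjoint (a i)) ∧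
    ∀ j < m, |‖evalPoly (p j) a‖ - ‖evalPoly (p j) x‖| < ε}

/-- The covering number of `Γ_top(x₁, …, xₙ; k, ε, m)` by `ω`-balls of the operator norm. -/
def nuTop (p : ℕ → FreeAlgebra ℂ (Fin n)) (x : Fin n → A) (k : ℕ) (ε : ℝ) (m : ℕ) (ω : ℝ) : ℕ∞ :=
  coveringNumber (gammaTop p x k ε m) ω

/-- `δ_top(x₁, …, xₙ; ω)`, with values in `[-∞, ∞]`; here `log 0 = -∞` and `log ∞ = ∞`. -/
def deltaTopAt (p : ℕ → FreeAlgebra ℂ (Fin n)) (x : Fin n → A) (ω : ℝ) : EReal :=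
  ⨅ (ε : ℝ) (_ : 0 < ε) (m : ℕ),
    limsup (fun k : ℕ =>
      ENNReal.log (nuTop p x k ε m ω : ENNReal) / ((-((k : ℝ) ^ 2 * Real.log ω) : ℝ) : EReal)) atTop

/-- Voiculescu's topological free entropy dimension
`δ_top(x₁, …, xₙ) = limsup_{ω → 0⁺} δ_top(x₁, …, xₙ; ω)`. -/
def deltaTop (p : ℕ → FreeAlgebra ℂ (Fin n)) (x : Fin n → A) : EReal :=
  limsup (fun ω : ℝ => deltaTopAt p x ω) (𝓝[>] 0)

end Microstates

end TopFreeEntropy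

end

noncomputable section

namespace TopFreeEntropy

/-! A microstate is, up to a small error, unitarily conjugate to a block diagonal tuple in which
every block is repeated at least `2 ^ s` times. The unitary costs `k ^ 2` real parameters, which
accounts for the bound 1; the blocks cost at most `n * (k / 2 ^ s) ^ 2`, which is negligible as `s`
grows.

The repetition comes from approximate divisibility. An approximately central subalgebra of subrank
at least 2 contains partial isometries `v a` whose ranges decompose 1 and whose initial projections
agree in groups of two or three. Multiplying `s` successive such families gives
`IsApproximatelyDivisible.exists_isApproxColumnSystem`, with groups of size at least `2 ^ s`. The
approximate relations are strict norm inequalities, so the `v a` may be taken to be polynomials in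
the generators, and the inequalities then pass to microstates
(`IsRationalEnumeration.exists_columnSystem`).

In `M_k` these relations can be made exact: `exists_blockSum_near` produces a unitary `U`, depending
on the column system alone, with `A` close to `U * blockSum e _ * Uᴴ` for every self-adjoint `A` of
bounded norm that almost commutes with the system. The block attached to `a` depends on `β a` only.

For counting, `U` is written as `exp (i H)` with `‖H‖ ≤ π`. The parameters then form a ball in a
real space of dimension at most `k ^ 2 + n * ∑ b, m b ^ 2`, mapped to tuples with a Lipschitz
constant independent of `k`. A volume bound for nets gives covering numbers of order `(K / ω)` to
that dimension, times `(k + 1) ^ card I` for the choice of block sizes. Both `K` and this polynomial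
factor disappear in the limits. -/

/-! ### Column systems -/

/-- A family `v` of elements of a `*`-ring with pairwise orthogonal ranges summing to `1`, such that
`v a` and `v (β a)` have the same initial projection. -/
structure IsColumnSystem {R I : Type*} [Ring R] [StarRing R] [Fintype I] (β : I → I)
    (v : I → R) : Prop where
  orth : ∀ a b, a ≠ b → star (v a) * v b = 0
  init : ∀ a, star (v a) * v a = star (v (β a)) * v (β a)
  sum : ∑ a, v a * star (v a) = 1

/-- The relations of a column system, up to `ε`. -/
structure IsApproxColumnSystem {R I : Type*} [NormedRing R] [StarRing R] [Fintype I] (β : I → I)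
    (v : I → R) (ε : ℝ) : Prop where
  norm_lt : ∀ a, ‖v a‖ < 2
  orth : ∀ a b, a ≠ b → ‖star (v a) * v b‖ < ε
  init : ∀ a, ‖star (v a) * v a - star (v (β a)) * v (β a)‖ < ε
  sum : ‖∑ a, v a * star (v a) - 1‖ < ε

lemma IsColumnSystem.map {R S I F : Type*} [Ring R] [StarRing R] [Ring S] [StarRing S] [Fintype I]
    [FunLike F R S] [RingHomClass F R S] [StarHomClass F R S] {β : I → I} {v : I → R}
    (h : IsColumnSystem β v) (f : F) : IsColumnSystem β (fun a => f (v a)) where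
  orth a b hab := by rw [← map_star, ← map_mul, h.orth a b hab, map_zero]
  init a := by simp only [← map_star, ← map_mul, h.init a]
  sum := by simp only [← map_star, ← map_mul, ← map_sum, h.sum, map_one]

lemma IsColumnSystem.pi {ι I : Type*} {R : ι → Type*} [∀ i, Ring (R i)] [∀ i, StarRing (R i)]
    [Fintype I] {β : I → I} {v : ∀ i, I → R i} (h : ∀ i, IsColumnSystem β (v i)) :
    IsColumnSystem β (fun a i => v i a) where
  orth a b hab := by ext i; simpa using (h i).orth a b hab
  init a := by ext i; simpa using (h i).init a
  sum := by ext i; simpa using (h i).sum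

/-- Each `v a * star (v a)` is one of the positive summands of 1. The bound is needed because
approximate divisibility controls commutators only on the unit ball. -/
lemma IsColumnSystem.norm_le_one {A I : Type*} [CStarAlgebra A] [Fintype I] {β : I → I}
    {v : I → A} (h : IsColumnSystem β v) (a : I) : ‖v a‖ ≤ 1 := by
  let _ := CStarAlgebra.spectralOrder A
  have := CStarAlgebra.spectralOrderedRing A
  have h1 : v a * star (v a) ≤ 1 := by
    rw [← h.sum]
    exact Finset.single_le_sum (f := fun a => v a * star (v a))
      (fun b _ => mul_star_self_nonneg (v b)) (Finset.mem_univ a)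
  have h2 : ‖v a * star (v a)‖ ≤ 1 := by
    rcases subsingleton_or_nontrivial A with hA | hA
    · rw [Subsingleton.elim (v a * star (v a)) 0]; simp
    · simpa using CStarAlgebra.norm_le_norm_of_nonneg_of_le (mul_star_self_nonneg (v a)) h1
  rw [CStarRing.norm_self_mul_star] at h2
  nlinarith [norm_nonneg (v a)]

/-- Here `v a` is the sum of the matrix units from `g r` to `r` over the rows `r` with `f r = a`.
Its initial projection is diagonal, supported on the columns `g r` of these rows, and `hβ` says that
these columns agree for `a` and `β a`. -/
lemma isColumnSystem_matrix {X I : Type*} [Fintype X] [DecidableEq X] [Fintype I] [DecidableEq I]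
    {β : I → I} {f : X → I} {g : X → X} (hinj : ∀ r s, f r = f s → g r = g s → r = s)
    (hβ : ∀ a c, (∃ r, f r = a ∧ g r = c) ↔ ∃ r, f r = β a ∧ g r = c) :
    IsColumnSystem β (fun a => (Matrix.of fun r c => if f r = a ∧ g r = c then 1 else 0 :
      Matrix X X ℂ)) := by
  have key : ∀ a c, (∑ r, if f r = a ∧ g r = c then (1 : ℂ) else 0) =
      if ∃ r, f r = a ∧ g r = c then 1 else 0 := by
    intro a c
    split_ifs with h
    · obtain ⟨r, h1, h2⟩ := h
      rw [Finset.sum_eq_single r]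
      · simp [h1, h2]
      · intro s _ hs
        rw [if_neg]
        rintro ⟨h3, h4⟩
        exact hs (hinj s r (h3.trans h1.symm) (h4.trans h2.symm))
      · simp
    · exact Finset.sum_eq_zero fun r _ => if_neg fun hr => h ⟨r, hr⟩
  have init : ∀ a, star (Matrix.of fun r c => if f r = a ∧ g r = c then (1 : ℂ) else 0) *
      (Matrix.of fun r c => if f r = a ∧ g r = c then (1 : ℂ) else 0 : Matrix X X ℂ) =
      Matrix.diagonal fun c => if ∃ r, f r = a ∧ g r = c then 1 else 0 := by
    intro a
    ext c c'
    rw [Matrix.mul_apply, Matrix.diagonal_apply, ← key]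
    split_ifs with hc
    · subst hc
      refine Finset.sum_congr rfl fun r _ => ?_
      by_cases h : f r = a ∧ g r = c <;> simp [h, Matrix.star_apply]
    · refine Finset.sum_eq_zero fun r _ => ?_
      by_cases h : f r = a ∧ g r = c
      · have : ¬ (f r = a ∧ g r = c') := fun h' => hc (h.2.symm.trans h'.2)
        simp [this]
      · simp [h, Matrix.star_apply]
  refine ⟨fun a b hab => ?_, fun a => ?_, ?_⟩
  · ext c c'
    rw [Matrix.mul_apply]
    refine Finset.sum_eq_zero fun r _ => ?_
    by_cases h : f r = a
    · have : ¬ (f r = b ∧ g r = c') := fun h' => hab (h.symm.trans h'.1)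
      simp [this]
    · simp [h, Matrix.star_apply]
  · rw [init, init]
    congr 1
    ext c
    simp only [hβ a c]
  · ext r r'
    rw [Matrix.sum_apply]
    simp only [Matrix.mul_apply, Matrix.star_apply, Matrix.of_apply]
    rw [Finset.sum_eq_single (f r), Finset.sum_eq_single (g r)]
    · by_cases h : r = r'
      · subst h; simp
      · have : ¬ (f r' = f r ∧ g r' = g r) := fun h' => h (hinj _ _ h'.1.symm h'.2.symm)
        simp [this, h]
    · intro b _ hb
      simp [hb.symm]
    · simp
    · intro b _ hb
      simp [hb.symm]
    · simp

/-- The block structure of `M₂ ⊕ M₃`. -/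
def baseTwoThree : Fin 5 → Fin 5 := ![0, 0, 2, 2, 2]

lemma exists_isColumnSystem_matrix {k : ℕ} (hk : 2 ≤ k) :
    ∃ v : Fin 5 → Matrix (Fin k) (Fin k) ℂ, IsColumnSystem baseTwoThree v := by
  -- The rows are cut into consecutive pairs (labels 0, 1) and, for odd `k`, one final triple
  -- (labels 2, 3, 4). `f` is the position within the group, `g` the first row of the group. For
  -- even `k` the last three matrices are zero, which the relations allow.
  let f : Fin k → Fin 5 := fun r =>
    if k % 2 = 1 ∧ k ≤ r.1 + 3 then ⟨(r.1 + 3 - k) % 3 + 2, by omega⟩ else ⟨r.1 % 2, by omega⟩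
  let g : Fin k → Fin k := fun r =>
    if k % 2 = 1 ∧ k ≤ r.1 + 3 then ⟨k - 3, by omega⟩ else ⟨r.1 - r.1 % 2, by omega⟩
  refine ⟨_, isColumnSystem_matrix (f := f) (g := g) ?_ ?_⟩
  · intro r s h1 h2
    ext
    have hr := r.2
    have hs := s.2
    simp only [f, g] at h1 h2
    split_ifs at h1 h2 <;> simp only [Fin.mk.injEq] at h1 h2 <;> omega
  · have main : ∀ (a b : Fin 5), (a.1 < 2 ↔ b.1 < 2) → ∀ c, (∃ r, f r = a ∧ g r = c) →
        ∃ r, f r = b ∧ g r = c := by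
      rintro a b hab c ⟨r, rfl, rfl⟩
      have hr := r.2
      have hb := b.2
      by_cases h : k % 2 = 1 ∧ k ≤ r.1 + 3
      · have hfr : (f r).1 = (r.1 + 3 - k) % 3 + 2 := by simp only [f, if_pos h]
        have h2 : 2 ≤ b.1 := by omega
        have h' : k % 2 = 1 ∧ k ≤ k - 3 + (b.1 - 2) + 3 := by omega
        refine ⟨⟨k - 3 + (b.1 - 2), by omega⟩, ?_, ?_⟩
        · ext
          simp only [f, if_pos h']
          omega
        · simp only [g, if_pos h, if_pos h']
      · have hfr : (f r).1 = r.1 % 2 := by simp only [f, if_neg h]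
        have h2 : b.1 < 2 := by omega
        have h' : ¬ (k % 2 = 1 ∧ k ≤ r.1 - r.1 % 2 + b.1 + 3) := by omega
        refine ⟨⟨r.1 - r.1 % 2 + b.1, by omega⟩, ?_, ?_⟩
        · ext
          simp only [f, if_neg h']
          omega
        · ext
          simp only [g, if_neg h, if_neg h']
          omega
    intro a c
    have hab : a.1 < 2 ↔ (baseTwoThree a).1 < 2 := by fin_cases a <;> simp [baseTwoThree]
    exact ⟨main _ _ hab c, main _ _ hab.symm c⟩

lemma IsApproximatelyDivisible.exists_isColumnSystem {A : Type*} [CStarAlgebra A]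
    (hA : IsApproximatelyDivisible A) {ι : Type*} [Fintype ι] (y : ι → A) {ε : ℝ} (hε : 0 < ε) :
    ∃ v : Fin 5 → A, IsColumnSystem baseTwoThree v ∧ ∀ i a, ‖y i * v a - v a * y i‖ < ε := by
  obtain ⟨B, -, hB, hc⟩ := hA (Fintype.card ι) (y ∘ (Fintype.equivFin ι).symm) ε hε
  unfold subRank at hB
  set s := {d : ℕ | ∃ (r : ℕ) (k : Fin r → ℕ), (∀ i, 0 < k i) ∧
    Nonempty (B ≃⋆ₐ[ℂ] (∀ i : Fin r, Matrix (Fin (k i)) (Fin (k i)) ℂ)) ∧ ∃ i, k i = d} with hs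
  -- The infimum of the empty set is 0, so subrank at least 2 already provides a decomposition into
  -- matrix blocks.
  have hne : s.Nonempty := by
    by_contra h
    rw [Set.not_nonempty_iff_eq_empty.1 h, Nat.sInf_empty] at hB
    omega
  obtain ⟨d, r, k, hk, ⟨φ⟩, hd⟩ := hne
  have hk2 : ∀ i, 2 ≤ k i := fun i => hB.trans (Nat.sInf_le ⟨r, k, hk, ⟨φ⟩, i, rfl⟩)
  choose v hv using fun i => exists_isColumnSystem_matrix (hk2 i)
  have h1 := ((IsColumnSystem.pi hv).map φ.symm).map B.subtype
  refine ⟨_, h1, fun i a => ?_⟩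
  have := hc (Fintype.equivFin ι i) _ (SetLike.coe_mem (φ.symm fun i => v i a)) (h1.norm_le_one a)
  simpa using this

/-- Products of column systems multiply the fibers of `β`, and each step contributes a factor of at
least 2. The index data are fixed before `y` and `ε`, since the later tolerances depend on `card I`.
-/
lemma IsApproximatelyDivisible.exists_isApproxColumnSystem {A : Type*} [CStarAlgebra A]
    (hA : IsApproximatelyDivisible A) (s : ℕ) :
    ∃ (I : Type) (_ : Fintype I) (_ : DecidableEq I) (β : I → I), (∀ a, β (β a) = β a) ∧
      (∀ a, 2 ^ s ≤ (Finset.univ.filter fun b => β b = β a).card) ∧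
      ∀ (l : ℕ) (y : Fin l → A) (ε : ℝ), 0 < ε →
        ∃ v : I → A, IsApproxColumnSystem β v ε ∧ ∀ i a, ‖y i * v a - v a * y i‖ < ε := by
  induction s with
  | zero =>
    refine ⟨Unit, inferInstance, inferInstance, id, by simp, by simp, fun l y ε hε =>
      ⟨fun _ => 1, ⟨fun _ => ?_, by simp, by simpa, by simpa⟩, by simpa using fun _ => hε⟩⟩
    rcases subsingleton_or_nontrivial A with h | h
    · rw [Subsingleton.elim (1 : A) 0]; simp
    · simp
  | succ s ih =>
    obtain ⟨I, _, _, β, hββ, hcard, ih⟩ := ih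
    refine ⟨I × Fin 5, inferInstance, inferInstance, Prod.map β baseTwoThree, ?_, ?_, ?_⟩
    · rintro ⟨a, a'⟩
      ext1
      · exact hββ a
      · fin_cases a' <;> rfl
    · rintro ⟨a, a'⟩
      have : (Finset.univ.filter fun b : I × Fin 5 =>
          Prod.map β baseTwoThree b = Prod.map β baseTwoThree (a, a')) =
          (Finset.univ.filter fun b => β b = β a) ×ˢ
          (Finset.univ.filter fun b => baseTwoThree b = baseTwoThree a') := by
        ext ⟨b, b'⟩
        simp
      rw [this, Finset.card_product, pow_succ]
      refine Nat.mul_le_mul (hcard a) ?_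
      fin_cases a' <;> decide
    · intro l y ε hε
      obtain ⟨v, hv, hvy⟩ := ih l y (ε / 2) (by positivity)
      -- The new system must almost commute with the old initial projections too: then `star (v a *
      -- w b) * (v a * w c)` is close to `star (v a) * v a * (star (w b) * w c)`.
      obtain ⟨w, hw, hwy⟩ := hA.exists_isColumnSystem
        (Sum.elim y fun a => star (v a) * v a) (ε := ε / 4) (by positivity)
      have hw1 := hw.norm_le_one
      have hw1' : ∀ a, ‖star (w a)‖ ≤ 1 := fun a => by rw [norm_star]; exact hw1 a
      have hwv : ∀ a b, ‖star (v a) * v a * w b - w b * (star (v a) * v a)‖ < ε / 4 := fun a b =>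
        hwy (Sum.inr a) b
      have hwv' : ∀ a b,
          ‖star (w b) * (star (v a) * v a) - star (v a) * v a * star (w b)‖ < ε / 4 := fun a b => by
        have := hwv a b
        rw [← norm_star] at this
        simpa only [star_sub, star_mul, star_star] using this
      have hbound : ∀ {p q : A} {c : ℝ}, ‖p‖ < c → ‖q‖ ≤ 1 → ‖p * q‖ < c := fun {p q c} hp hq =>
        (norm_mul_le p q).trans_lt (by nlinarith [norm_nonneg p, norm_nonneg q])
      have hbound' : ∀ {p q : A} {c : ℝ}, ‖p‖ ≤ 1 → ‖q‖ < c → ‖p * q‖ < c := fun {p q c} hp hq =>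
        (norm_mul_le p q).trans_lt (by nlinarith [norm_nonneg p, norm_nonneg q])
      refine ⟨fun a => v a.1 * w a.2, ⟨?_, ?_, ?_, ?_⟩, ?_⟩
      · exact fun a => hbound (hv.norm_lt a.1) (hw1 a.2)
      · rintro ⟨a, a'⟩ ⟨b, b'⟩ hab
        by_cases h : a = b
        · subst h
          have h' : a' ≠ b' := fun h => hab (by rw [h])
          have : star (v a * w a') * (v a * w b') =
              (star (w a') * (star (v a) * v a) - star (v a) * v a * star (w a')) * w b' := by
            rw [star_mul, sub_mul, mul_assoc (star (v a) * v a), hw.orth a' b' h']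
            noncomm_ring
          rw [this]
          linarith [hbound (hwv' a a') (hw1 b')]
        · have : star (v a * w a') * (v b * w b') = star (w a') * (star (v a) * v b) * w b' := by
            rw [star_mul]; noncomm_ring
          rw [this]
          linarith [hbound (hbound' (hw1' a') (hv.orth a b h)) (hw1 b')]
      · rintro ⟨a, a'⟩
        have e : ∀ a a', star (v a * w a') * (v a * w a') =
            (star (w a') * (star (v a) * v a) - star (v a) * v a * star (w a')) * w a'
            + star (v a) * v a * (star (w a') * w a') := by
          intro a a'
          rw [star_mul]; noncomm_ring
        have : star (v a * w a') * (v a * w a') -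
            star (v (β a) * w (baseTwoThree a')) * (v (β a) * w (baseTwoThree a')) =
            (star (w a') * (star (v a) * v a) - star (v a) * v a * star (w a')) * w a' +
            (star (v a) * v a - star (v (β a)) * v (β a)) * (star (w a') * w a') -
            (star (w (baseTwoThree a')) * (star (v (β a)) * v (β a)) -
              star (v (β a)) * v (β a) * star (w (baseTwoThree a'))) * w (baseTwoThree a') := by
          rw [e, e, ← hw.init a']
          noncomm_ring
        simp only [Prod.map_apply]
        rw [this]
        refine (norm_sub_le _ _).trans_lt ?_
        have h1 := norm_add_le ((star (w a') * (star (v a) * v a) -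
            star (v a) * v a * star (w a')) * w a')
          ((star (v a) * v a - star (v (β a)) * v (β a)) * (star (w a') * w a'))
        have h2 := hbound (hwv' a a') (hw1 a')
        have h3 := hbound (hwv' (β a) (baseTwoThree a')) (hw1 (baseTwoThree a'))
        have h4 : ‖star (w a') * w a'‖ ≤ 1 :=
          (norm_mul_le _ _).trans (mul_le_one₀ (hw1' a') (norm_nonneg _) (hw1 a'))
        have h5 := hbound (hv.init a) h4
        linarith
      · have : ∑ a : I × Fin 5, v a.1 * w a.2 * star (v a.1 * w a.2) =
            ∑ a, v a * star (v a) := by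
          rw [Fintype.sum_prod_type]
          refine Finset.sum_congr rfl fun a _ => ?_
          have : ∀ b, v a * w b * star (v a * w b) = v a * (w b * star (w b)) * star (v a) :=
            fun b => by rw [star_mul]; noncomm_ring
          simp only [this]
          rw [← Finset.sum_mul, ← Finset.mul_sum, hw.sum, mul_one]
        rw [this]
        linarith [hv.sum]
      · rintro i ⟨a, a'⟩
        have : y i * (v a * w a') - v a * w a' * y i =
            (y i * v a - v a * y i) * w a' + v a * (y i * w a' - w a' * y i) := by
          noncomm_ring
        simp only
        rw [this]
        refine (norm_add_le _ _).trans_lt ?_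
        have h1 := hbound (hvy i a) (hw1 a')
        have h2 : ‖y i * w a' - w a' * y i‖ < ε / 4 := hwy (Sum.inl i) a'
        have h3 := norm_mul_le (v a) (y i * w a' - w a' * y i)
        nlinarith [hv.norm_lt a, norm_nonneg (v a), norm_nonneg (y i * w a' - w a' * y i)]

/-! ### Noncommutative polynomials -/

section Polynomials

variable {n : ℕ}

lemma evalPoly_eq_sum {R : Type*} [Ring R] [Algebra ℂ R] (q : FreeAlgebra ℂ (Fin n))
    (y : Fin n → R) :
    evalPoly q y = (FreeAlgebra.equivMonoidAlgebraFreeMonoid q).coeff.sum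
      fun w c => c • FreeMonoid.lift y w := by
  have : FreeAlgebra.lift ℂ y = ((MonoidAlgebra.lift ℂ R (FreeMonoid (Fin n))
      (FreeMonoid.lift y)).comp
      (FreeAlgebra.equivMonoidAlgebraFreeMonoid (R := ℂ) (X := Fin n)).toAlgHom) := by
    ext i
    simp [FreeAlgebra.equivMonoidAlgebraFreeMonoid]
  unfold evalPoly
  rw [this, AlgHom.comp_apply, MonoidAlgebra.lift_apply]
  rfl

lemma norm_freeMonoid_lift_le {R : Type*} [NormedRing R] (h1 : ‖(1 : R)‖ ≤ 1) {y : Fin n → R}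
    {c : ℝ} (hy : ∀ i, ‖y i‖ ≤ c) (w : FreeMonoid (Fin n)) :
    ‖FreeMonoid.lift y w‖ ≤ c ^ w.length := by
  induction w using FreeMonoid.inductionOn' with
  | one => simpa using h1
  | of_mul i w ih =>
    rw [map_mul, FreeMonoid.lift_eval_of, FreeMonoid.length_mul, FreeMonoid.length_of, pow_add,
      pow_one]
    exact (norm_mul_le _ _).trans
      (mul_le_mul (hy i) ih (norm_nonneg _) ((norm_nonneg _).trans (hy i)))

lemma exists_ratComplex_near (z : ℂ) {η : ℝ} (hη : 0 < η) :
    ∃ a b : ℚ, ‖(a : ℂ) + (b : ℂ) * Complex.I - z‖ < η := by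
  obtain ⟨a, ha1, ha2⟩ := exists_rat_btwn (show z.re < z.re + η / 2 by linarith)
  obtain ⟨b, hb1, hb2⟩ := exists_rat_btwn (show z.im < z.im + η / 2 by linarith)
  refine ⟨a, b, (Complex.norm_le_abs_re_add_abs_im _).trans_lt ?_⟩
  have h1 : ((a : ℂ) + (b : ℂ) * Complex.I - z).re = a - z.re := by simp
  have h2 : ((a : ℂ) + (b : ℂ) * Complex.I - z).im = b - z.im := by simp
  rw [h1, h2, abs_of_pos (by linarith), abs_of_pos (by linarith)]
  linarith

/-- Not enlarging the support makes the evaluation error uniform over all tuples of bounded norm,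
whatever the matrix size. -/
lemma exists_hasRationalCoeffs_near (q : FreeAlgebra ℂ (Fin n)) {η : ℝ} (hη : 0 < η) :
    ∃ q' : FreeAlgebra ℂ (Fin n), HasRationalCoeffs q' ∧
      (FreeAlgebra.equivMonoidAlgebraFreeMonoid (q' - q)).coeff.support ⊆
        (FreeAlgebra.equivMonoidAlgebraFreeMonoid q).coeff.support ∧
      ∀ w, ‖(FreeAlgebra.equivMonoidAlgebraFreeMonoid (q' - q)).coeff w‖ ≤ η := by
  have h : ∀ z : ℂ, ∃ z' : ℂ, (∃ a b : ℚ, z' = (a : ℂ) + (b : ℂ) * Complex.I) ∧ ‖z' - z‖ ≤ η ∧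
      (z = 0 → z' = 0) := by
    intro z
    by_cases hz : z = 0
    · exact ⟨0, ⟨0, 0, by simp⟩, by simp [hz, hη.le], fun _ => rfl⟩
    · obtain ⟨a, b, hab⟩ := exists_ratComplex_near z hη
      exact ⟨_, ⟨a, b, rfl⟩, hab.le, fun h => absurd h hz⟩
  choose f hf1 hf2 hf3 using h
  set φ := FreeAlgebra.equivMonoidAlgebraFreeMonoid (R := ℂ) (X := Fin n) with hφ
  let q' := φ.symm (.ofCoeff ((φ q).coeff.mapRange f (hf3 0 rfl)))
  have hq' : ∀ w, (φ q').coeff w = f ((φ q).coeff w) := by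
    intro w
    simp [q', MonoidAlgebra.coeff_ofCoeff]
  have hsub : ∀ w, (φ (q' - q)).coeff w = f ((φ q).coeff w) - (φ q).coeff w := by
    intro w
    rw [map_sub, ← hq' w]
    simp [MonoidAlgebra.coeff_sub]
  refine ⟨q', fun w => ?_, fun w hw => ?_, fun w => ?_⟩
  · rw [← hφ, hq']
    exact hf1 _
  · rw [Finsupp.mem_support_iff, hsub] at hw
    rw [Finsupp.mem_support_iff]
    intro h
    exact hw (by rw [h, hf3 0 rfl, sub_zero])
  · rw [hsub]
    exact hf2 _

lemma norm_evalPoly_le {R : Type*} [NormedRing R] [NormedAlgebra ℂ R] (h1 : ‖(1 : R)‖ ≤ 1)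
    {y : Fin n → R} {c : ℝ} (hy : ∀ i, ‖y i‖ ≤ c) {q : FreeAlgebra ℂ (Fin n)}
    {s : Finset (FreeMonoid (Fin n))} {η : ℝ}
    (hs : (FreeAlgebra.equivMonoidAlgebraFreeMonoid q).coeff.support ⊆ s)
    (hq : ∀ w, ‖(FreeAlgebra.equivMonoidAlgebraFreeMonoid q).coeff w‖ ≤ η) :
    ‖evalPoly q y‖ ≤ η * ∑ w ∈ s, c ^ w.length := by
  rw [evalPoly_eq_sum, Finsupp.sum_of_support_subset _ hs _ (by simp), Finset.mul_sum]
  refine norm_sum_le_of_le _ fun w _ => ?_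
  rw [norm_smul]
  exact mul_le_mul (hq w) (norm_freeMonoid_lift_le h1 hy w) (norm_nonneg _)
    ((norm_nonneg _).trans (hq w))

/-- `AdjointPoly q q'` says that `q'` is obtained from `q` by reversing the words and conjugating
the coefficients. -/
inductive AdjointPoly : FreeAlgebra ℂ (Fin n) → FreeAlgebra ℂ (Fin n) → Prop
  | algebraMap (c : ℂ) : AdjointPoly (algebraMap ℂ _ c) (algebraMap ℂ _ (star c))
  | ι (i : Fin n) : AdjointPoly (FreeAlgebra.ι ℂ i) (FreeAlgebra.ι ℂ i)
  | add {q r q' r' : FreeAlgebra ℂ (Fin n)} : AdjointPoly q q' → AdjointPoly r r' →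
      AdjointPoly (q + r) (q' + r')
  | mul {q r q' r' : FreeAlgebra ℂ (Fin n)} : AdjointPoly q q' → AdjointPoly r r' →
      AdjointPoly (q * r) (r' * q')

lemma exists_adjointPoly (q : FreeAlgebra ℂ (Fin n)) : ∃ q', AdjointPoly q q' := by
  induction q using FreeAlgebra.induction with
  | grade0 c => exact ⟨_, .algebraMap c⟩
  | grade1 i => exact ⟨_, .ι i⟩
  | mul q r hq hr =>
    obtain ⟨q', hq⟩ := hq
    obtain ⟨r', hr⟩ := hr
    exact ⟨_, hq.mul hr⟩
  | add q r hq hr =>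
    obtain ⟨q', hq⟩ := hq
    obtain ⟨r', hr⟩ := hr
    exact ⟨_, hq.add hr⟩

lemma AdjointPoly.evalPoly_eq {q q' : FreeAlgebra ℂ (Fin n)} (h : AdjointPoly q q') {R : Type*}
    [Ring R] [StarRing R] [Algebra ℂ R] [StarModule ℂ R] {y : Fin n → R}
    (hy : ∀ i, IsSelfAdjoint (y i)) : evalPoly q' y = star (evalPoly q y) := by
  unfold evalPoly
  induction h with
  | algebraMap c => simp only [AlgHom.commutes, algebraMap_star_comm]
  | ι i => simp only [FreeAlgebra.lift_ι_apply, (hy i).star_eq]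
  | add _ _ h1 h2 => rw [map_add, map_add, star_add, h1, h2]
  | mul _ _ h1 h2 => rw [map_mul, map_mul, star_mul, h1, h2]

lemma Generates.denseRange_evalPoly {A : Type*} [CStarAlgebra A] {x : Fin n → A}
    (hx : ∀ i, IsSelfAdjoint (x i)) (hgen : Generates x) :
    DenseRange fun q : FreeAlgebra ℂ (Fin n) => evalPoly q x := by
  have h1 : star (Set.range x) = Set.range x := by
    ext z
    simp only [Set.mem_star, Set.mem_range]
    constructor
    · rintro ⟨i, hi⟩
      exact ⟨i, by rw [← star_star z, ← hi, (hx i).star_eq]⟩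
    · rintro ⟨i, rfl⟩
      exact ⟨i, (hx i).star_eq.symm⟩
  have h2 : Set.range (fun q : FreeAlgebra ℂ (Fin n) => evalPoly q x) =
      (StarAlgebra.adjoin ℂ (Set.range x) : Set A) := by
    rw [← StarSubalgebra.coe_toSubalgebra, StarAlgebra.adjoin_toSubalgebra, h1, Set.union_self,
      Algebra.adjoin_range_eq_range_freeAlgebra_lift]
    rfl
  unfold DenseRange
  rw [h2, dense_iff_closure_eq, ← StarSubalgebra.topologicalClosure_coe]
  unfold Generates at hgen
  rw [hgen]
  rfl

end Polynomials

/-! ### Relations in microstates -/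

section Relations

open scoped Matrix.Norms.L2Operator

/-- An inequality, because the zero algebra and `0 × 0` matrices must be covered. -/
lemma norm_one_le_one {A : Type*} [CStarAlgebra A] : ‖(1 : A)‖ ≤ 1 := by
  rcases subsingleton_or_nontrivial A with h | h
  · rw [Subsingleton.elim (1 : A) 0]; simp
  · simp

variable {A : Type*} [CStarAlgebra A] {n : ℕ} {p : ℕ → FreeAlgebra ℂ (Fin n)} {x : Fin n → A}

lemma gammaTop_mono {k : ℕ} {ε ε' : ℝ} {m m' : ℕ} (hε : ε ≤ ε') (hm : m' ≤ m) :
    gammaTop p x k ε m ⊆ gammaTop p x k ε' m' := fun _ ha =>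
  ⟨ha.1, fun j hj => (ha.2 j (hj.trans_le hm)).trans_le hε⟩

lemma hasRationalCoeffs_ι (i : Fin n) : HasRationalCoeffs (FreeAlgebra.ι ℂ i) := by
  intro w
  have : FreeAlgebra.equivMonoidAlgebraFreeMonoid (FreeAlgebra.ι ℂ i) =
      MonoidAlgebra.of ℂ (FreeMonoid (Fin n)) (.of i) := by
    simp [FreeAlgebra.equivMonoidAlgebraFreeMonoid]
  rw [this, MonoidAlgebra.of_apply, MonoidAlgebra.coeff_single]
  classical
  rw [Finsupp.single_apply]
  split_ifs
  · exact ⟨1, 0, by simp⟩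
  · exact ⟨0, 0, by simp⟩

lemma IsRationalEnumeration.exists_norm_le (hp : IsRationalEnumeration p) :
    ∃ m, ∀ k, ∀ a ∈ gammaTop p x k 1 m, ∀ i, ‖a i‖ ≤ ‖x i‖ + 1 := by
  have h : ∀ i, ∃ j, p j = FreeAlgebra.ι ℂ i := fun i => by
    have : FreeAlgebra.ι ℂ i ∈ Set.range p := by
      rw [hp]
      exact hasRationalCoeffs_ι i
    exact this
  choose j hj using h
  refine ⟨Finset.univ.sup j + 1, fun k a ha i => ?_⟩
  have := ha.2 (j i) (Nat.lt_succ_of_le (Finset.le_sup (Finset.mem_univ i)))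
  rw [hj] at this
  simp only [evalPoly, FreeAlgebra.lift_ι_apply] at this
  linarith [(abs_lt.1 this).2]

/-- Rational polynomials approximate `q` uniformly on tuples bounded by `‖x‖ + 1`, and microstates
are so bounded because the indeterminates are themselves in the enumeration. Only the upper half of
the microstate inequalities is used. -/
lemma IsRationalEnumeration.exists_norm_evalPoly_lt (hp : IsRationalEnumeration p)
    {q : FreeAlgebra ℂ (Fin n)} {c : ℝ} (hq : ‖evalPoly q x‖ < c) :
    ∃ ε > 0, ∃ m, ∀ k, ∀ a ∈ gammaTop p x k ε m, ‖evalPoly q a‖ < c := by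
  obtain ⟨m₀, hm₀⟩ := hp.exists_norm_le (x := x)
  set s := (FreeAlgebra.equivMonoidAlgebraFreeMonoid q).coeff.support
  set C : ℝ := ‖x‖ + 1 with hC
  set M : ℝ := ∑ w ∈ s, C ^ w.length + 1 with hM
  have hM0 : 0 < M := by positivity
  -- Three errors of size at most `δ` occur: replacing `q` by `q'` at `a`, passing from `a` to `x`,
  -- and returning to `q` at `x`.
  set δ := (c - ‖evalPoly q x‖) / 4 with hδ
  have hδ0 : 0 < δ := by rw [hδ]; linarith
  obtain ⟨q', hq', hs, hη⟩ := exists_hasRationalCoeffs_near q (div_pos hδ0 hM0)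
  have hsmall : δ / M * ∑ w ∈ s, C ^ w.length ≤ δ := by
    rw [div_mul_eq_mul_div, div_le_iff₀ hM0]
    exact mul_le_mul_of_nonneg_left (by rw [hM]; linarith) hδ0.le
  obtain ⟨j, hj⟩ : q' ∈ Set.range p := by rw [hp]; exact hq'
  refine ⟨min δ 1, by positivity, max m₀ (j + 1), fun k a ha => ?_⟩
  have h1 := hm₀ k a (gammaTop_mono (min_le_right _ _) (le_max_left _ _) ha)
  have h2 := (abs_lt.1 (ha.2 j (lt_of_lt_of_le (Nat.lt_succ_self j) (le_max_right _ _)))).2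
  rw [hj] at h2
  have h3 := (norm_evalPoly_le norm_one_le_one (y := a)
    (fun i => (h1 i).trans (by rw [hC]; linarith [norm_le_pi_norm x i])) hs hη).trans hsmall
  have h4 := (norm_evalPoly_le norm_one_le_one (y := x)
    (fun i => by rw [hC]; linarith [norm_le_pi_norm x i]) hs hη).trans hsmall
  rw [evalPoly, map_sub] at h3 h4
  have h5 := abs_le.1 ((abs_norm_sub_norm_le _ _).trans h3)
  have h6 := abs_le.1 ((abs_norm_sub_norm_le _ _).trans h4)
  simp only [evalPoly] at h2 hδ ⊢
  linarith [min_le_left δ 1, h5.1, h6.2]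

lemma IsRationalEnumeration.exists_forall_norm_evalPoly_lt (hp : IsRationalEnumeration p)
    {ι : Type*} [Finite ι] {q : ι → FreeAlgebra ℂ (Fin n)} {c : ι → ℝ}
    (hq : ∀ l, ‖evalPoly (q l) x‖ < c l) :
    ∃ ε > 0, ∃ m, ∀ k, ∀ a ∈ gammaTop p x k ε m, ∀ l, ‖evalPoly (q l) a‖ < c l := by
  cases nonempty_fintype ι
  choose ε hε m h using fun l => hp.exists_norm_evalPoly_lt (hq l)
  obtain ⟨ε₀, hε₀, hle⟩ : ∃ ε₀ > 0, ∀ l, ε₀ ≤ ε l := by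
    rcases isEmpty_or_nonempty ι with hι | hι
    · exact ⟨1, one_pos, hι.elim⟩
    · obtain ⟨l, hl⟩ := Finite.exists_min ε
      exact ⟨ε l, hε l, hl⟩
  exact ⟨ε₀, hε₀, Finset.univ.sup m, fun k a ha l =>
    h l k a (gammaTop_mono (hle l) (Finset.le_sup (Finset.mem_univ l)) ha)⟩

/-- The relations are open conditions on `v`, and polynomial values are dense in `A`. -/
lemma exists_columnSystem_polynomials (hx : ∀ i, IsSelfAdjoint (x i)) (hgen : Generates x)
    {I : Type} [Fintype I] {β : I → I} {ε : ℝ} {v : I → A} (hv : IsApproxColumnSystem β v ε)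
    (hvx : ∀ i a, ‖x i * v a - v a * x i‖ < ε) :
    ∃ q : I → FreeAlgebra ℂ (Fin n), IsApproxColumnSystem β (fun a => evalPoly (q a) x) ε ∧
      ∀ i a, ‖x i * evalPoly (q a) x - evalPoly (q a) x * x i‖ < ε := by
  have h1 : ∀ᶠ w : I → A in 𝓝 v, ∀ a, ‖w a‖ < 2 := by
    rw [eventually_all]
    exact fun a => (by fun_prop : Continuous fun w : I → A => ‖w a‖).continuousAt.eventually_lt
      continuousAt_const (hv.norm_lt a)
  have h2 : ∀ᶠ w : I → A in 𝓝 v, ∀ a b, a ≠ b → ‖star (w a) * w b‖ < ε := by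
    simp only [eventually_all]
    exact fun a b hab =>
      (by fun_prop : Continuous fun w : I → A => ‖star (w a) * w b‖).continuousAt.eventually_lt
        continuousAt_const (hv.orth a b hab)
  have h3 : ∀ᶠ w : I → A in 𝓝 v,
      ∀ a, ‖star (w a) * w a - star (w (β a)) * w (β a)‖ < ε := by
    rw [eventually_all]
    exact fun a => (by fun_prop : Continuous fun w : I → A =>
      ‖star (w a) * w a - star (w (β a)) * w (β a)‖).continuousAt.eventually_lt
      continuousAt_const (hv.init a)
  have h4 : ∀ᶠ w : I → A in 𝓝 v, ‖∑ a, w a * star (w a) - 1‖ < ε :=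
    (by fun_prop : Continuous fun w : I → A =>
      ‖∑ a, w a * star (w a) - 1‖).continuousAt.eventually_lt continuousAt_const hv.sum
  have h5 : ∀ᶠ w : I → A in 𝓝 v, ∀ i a, ‖x i * w a - w a * x i‖ < ε := by
    simp only [eventually_all]
    exact fun i a => (by fun_prop : Continuous fun w : I → A =>
      ‖x i * w a - w a * x i‖).continuousAt.eventually_lt continuousAt_const (hvx i a)
  have hd : DenseRange (Pi.map fun (_ : I) (q : FreeAlgebra ℂ (Fin n)) => evalPoly q x) :=
    DenseRange.piMap fun _ => hgen.denseRange_evalPoly hx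
  obtain ⟨w, ⟨q, rfl⟩, g1, g2, g3, g4, g5⟩ := (mem_closure_iff_frequently.1 (hd v)).and_eventually
    (h1.and (h2.and (h3.and (h4.and h5)))) |>.exists
  exact ⟨q, ⟨g1, g2, g3, g4⟩, g5⟩

/-- On self-adjoint tuples adjoints of polynomial values are again polynomial values, so every
relation is a strict bound on the norm of a polynomial and transfers to microstates. -/
lemma IsRationalEnumeration.exists_columnSystem (hp : IsRationalEnumeration p)
    (hx : ∀ i, IsSelfAdjoint (x i)) (hgen : Generates x)
    {I : Type} [Fintype I] {β : I → I} {ε : ℝ} {v : I → A} (hv : IsApproxColumnSystem β v ε)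
    (hvx : ∀ i a, ‖x i * v a - v a * x i‖ < ε) :
    ∃ ε' > 0, ∃ m, ∀ k, ∀ a ∈ gammaTop p x k ε' m, (∀ i, ‖a i‖ ≤ ‖x i‖ + 1) ∧
      ∃ w : I → Matrix (Fin k) (Fin k) ℂ, IsApproxColumnSystem β w ε ∧
        ∀ i b, ‖a i * w b - w b * a i‖ < ε := by
  obtain ⟨q, hq, hqx⟩ := exists_columnSystem_polynomials hx hgen hv hvx
  choose q' hq' using fun a => exists_adjointPoly (q a)
  have hs : ∀ a, evalPoly (q' a) x = star (evalPoly (q a) x) := fun a => (hq' a).evalPoly_eq hx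
  have hs' : ∀ (k : ℕ) (y : Fin n → Matrix (Fin k) (Fin k) ℂ), (∀ i, IsSelfAdjoint (y i)) →
      ∀ a, evalPoly (q' a) y = star (evalPoly (q a) y) := fun k y hy a => (hq' a).evalPoly_eq hy
  obtain ⟨m₀, hm₀⟩ := hp.exists_norm_le (x := x)
  obtain ⟨ε₁, hε₁, m₁, h₁⟩ := hp.exists_forall_norm_evalPoly_lt (x := x) (q := q) (c := fun _ => 2)
    hq.norm_lt
  obtain ⟨ε₂, hε₂, m₂, h₂⟩ := hp.exists_forall_norm_evalPoly_lt (x := x)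
    (ι := {c : I × I // c.1 ≠ c.2}) (q := fun c => q' c.1.1 * q c.1.2) (c := fun _ => ε) (by
      rintro ⟨⟨a, b⟩, hab⟩
      have := hq.orth a b hab
      rw [← hs] at this
      simpa only [evalPoly, map_mul] using this)
  obtain ⟨ε₃, hε₃, m₃, h₃⟩ := hp.exists_forall_norm_evalPoly_lt (x := x)
    (q := fun a => q' a * q a - q' (β a) * q (β a)) (c := fun _ => ε) (by
      intro a
      have := hq.init a
      rw [← hs, ← hs] at this
      simpa only [evalPoly, map_mul, map_sub] using this)
  obtain ⟨ε₄, hε₄, m₄, h₄⟩ := hp.exists_norm_evalPoly_lt (x := x)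
    (q := ∑ a, q a * q' a - 1) (c := ε) (by
      have := hq.sum
      simp only [← hs] at this
      simpa only [evalPoly, map_mul, map_sub, map_sum, map_one] using this)
  obtain ⟨ε₅, hε₅, m₅, h₅⟩ := hp.exists_forall_norm_evalPoly_lt (x := x)
    (ι := Fin n × I) (q := fun c => FreeAlgebra.ι ℂ c.1 * q c.2 - q c.2 * FreeAlgebra.ι ℂ c.1)
    (c := fun _ => ε) (by
      rintro ⟨i, a⟩
      simpa only [evalPoly, map_mul, map_sub, FreeAlgebra.lift_ι_apply] using hqx i a)
  refine ⟨min 1 (min ε₁ (min ε₂ (min ε₃ (min ε₄ ε₅)))), by positivity,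
    max m₀ (max m₁ (max m₂ (max m₃ (max m₄ m₅)))), fun k a ha =>
    ⟨hm₀ k a (gammaTop_mono (by simp) (by simp) ha), fun b => evalPoly (q b) a, ⟨?_, ?_, ?_, ?_⟩, ?_⟩⟩
  · exact h₁ k a (gammaTop_mono (by simp) (by simp) ha)
  · intro b c hbc
    have := h₂ k a (gammaTop_mono (by simp) (by simp) ha) ⟨(b, c), hbc⟩
    rw [← hs' k a ha.1]
    simpa only [evalPoly, map_mul] using this
  · intro b
    have := h₃ k a (gammaTop_mono (by simp) (by simp) ha) b
    rw [← hs' k a ha.1, ← hs' k a ha.1]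
    simpa only [evalPoly, map_mul, map_sub] using this
  · have := h₄ k a (gammaTop_mono (by simp) (by simp) ha)
    simp only [← hs' k a ha.1]
    simpa only [evalPoly, map_mul, map_sub, map_sum, map_one] using this
  · intro i b
    have := h₅ k a (gammaTop_mono (by simp) (by simp) ha) (i, b)
    simpa only [evalPoly, map_mul, map_sub, FreeAlgebra.lift_ι_apply] using this

end Relations

/-! ### Perturbation of matrices -/

section Perturbation

open scoped Matrix.Norms.L2Operator
open Matrix

variable {X Y : Type*} [Fintype X] [Fintype Y]

lemma norm_le_one_of_conjTranspose_mul_self [DecidableEq Y] {W : Matrix X Y ℂ} (h : Wᴴ * W = 1) : ‖W‖ ≤ 1 := by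
  have := l2_opNorm_conjTranspose_mul_self W
  rw [h] at this
  nlinarith [norm_one_le_one (A := Matrix Y Y ℂ), norm_nonneg W]

variable [DecidableEq X]

lemma norm_mul_diagonal_mul_le {V : Matrix X X ℂ} (hV : Vᴴ * V = 1) {d : X → ℂ} {c : ℝ}
    (hc : 0 ≤ c) (hd : ∀ i, ‖d i‖ ≤ c) : ‖V * diagonal d * Vᴴ‖ ≤ c := by
  have h1 := norm_le_one_of_conjTranspose_mul_self hV
  have h2 : ‖Vᴴ‖ ≤ 1 := by rwa [l2_opNorm_conjTranspose]
  have h3 : ‖(diagonal d : Matrix X X ℂ)‖ ≤ c := by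
    rw [l2_opNorm_diagonal]
    exact (pi_norm_le_iff_of_nonneg hc).2 hd
  calc ‖V * diagonal d * Vᴴ‖ ≤ ‖V‖ * ‖(diagonal d : Matrix X X ℂ)‖ * ‖Vᴴ‖ :=
        norm_mul₃_le
    _ ≤ 1 * c * 1 := by gcongr
    _ = c := by ring

lemma norm_le_norm_mul_diagonal_mul {V : Matrix X X ℂ} (hV : Vᴴ * V = 1) (d : X → ℂ) (i : X) :
    ‖d i‖ ≤ ‖V * diagonal d * Vᴴ‖ := by
  have h1 := norm_le_one_of_conjTranspose_mul_self hV
  have h2 : ‖Vᴴ‖ ≤ 1 := by rwa [l2_opNorm_conjTranspose]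
  have h3 : (diagonal d : Matrix X X ℂ) = Vᴴ * (V * diagonal d * Vᴴ) * V := by
    calc (diagonal d : Matrix X X ℂ) = (Vᴴ * V) * diagonal d * (Vᴴ * V) := by simp [hV]
      _ = _ := by simp only [Matrix.mul_assoc]
  calc ‖d i‖ ≤ ‖(diagonal d : Matrix X X ℂ)‖ := by
        rw [l2_opNorm_diagonal]
        exact norm_le_pi_norm d i
    _ = ‖Vᴴ * (V * diagonal d * Vᴴ) * V‖ := by rw [← h3]
    _ ≤ ‖Vᴴ‖ * ‖V * diagonal d * Vᴴ‖ * ‖V‖ := norm_mul₃_le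
    _ ≤ 1 * ‖V * diagonal d * Vᴴ‖ * 1 := by gcongr
    _ = _ := by ring

lemma exists_diagonalization {h : Matrix X X ℂ} (hh : IsSelfAdjoint h) :
    ∃ (V : Matrix X X ℂ) (l : X → ℝ), Vᴴ * V = 1 ∧ V * Vᴴ = 1 ∧
      h = V * diagonal (fun i => (l i : ℂ)) * Vᴴ := by
  have hA : h.IsHermitian := hh
  refine ⟨hA.eigenvectorUnitary, hA.eigenvalues, ?_, ?_, ?_⟩
  · exact (Matrix.mem_unitaryGroup_iff').1 hA.eigenvectorUnitary.2
  · exact (Matrix.mem_unitaryGroup_iff).1 hA.eigenvectorUnitary.2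
  · conv_lhs => rw [hA.spectral_theorem]
    rfl

lemma conj_diagonal_mul {V : Matrix X X ℂ} (hV : Vᴴ * V = 1) (d d' : X → ℂ) :
    V * diagonal d * Vᴴ * (V * diagonal d' * Vᴴ) = V * diagonal (fun i => d i * d' i) * Vᴴ := by
  calc _ = V * diagonal d * (Vᴴ * V) * diagonal d' * Vᴴ := by simp only [Matrix.mul_assoc]
    _ = _ := by rw [hV, Matrix.mul_one, Matrix.mul_assoc V, diagonal_mul_diagonal]

lemma conj_diagonal_sub (V : Matrix X X ℂ) (d d' : X → ℂ) :
    V * diagonal d * Vᴴ - V * diagonal d' * Vᴴ = V * diagonal (fun i => d i - d' i) * Vᴴ := by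
  rw [← Matrix.sub_mul, ← Matrix.mul_sub, diagonal_sub]

/-- An approximate projection is close to the range projection of an isometry. -/
lemma exists_isometry_near {h : Matrix X X ℂ} (hh : IsSelfAdjoint h) {δ : ℝ}
    (hδ : ‖h * h - h‖ ≤ δ) :
    ∃ (m : ℕ) (W : Matrix X (Fin m) ℂ), Wᴴ * W = 1 ∧ ‖W * Wᴴ - h‖ ≤ 2 * δ := by
  classical
  obtain ⟨V, l, hV, -, hl⟩ := exists_diagonalization hh
  have hδ0 : 0 ≤ δ := (norm_nonneg _).trans hδ
  have hlδ : ∀ i, |l i * l i - l i| ≤ δ := fun i => by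
    have := (norm_le_norm_mul_diagonal_mul hV (fun i => ((l i : ℂ) * l i - l i)) i)
    rw [← conj_diagonal_sub, ← conj_diagonal_mul hV, ← hl] at this
    have h2 := this.trans hδ
    rwa [← Complex.ofReal_mul, ← Complex.ofReal_sub, Complex.norm_real, Real.norm_eq_abs] at h2
  -- Spectral cut at 1/2: from `|l| * |1 - l| ≤ δ`, an eigenvalue above 1/2 is within `2 * δ` of 1,
  -- and any other is within `2 * δ` of 0.
  let J := {i : X // 1 / 2 < l i}
  let e : Fin (Fintype.card J) ≃ J := (Fintype.equivFin J).symm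
  have hW : V.submatrix id (fun j => (e j).1) * (V.submatrix id fun j => (e j).1)ᴴ =
      V * diagonal (fun i => if 1 / 2 < l i then (1 : ℂ) else 0) * Vᴴ := by
    ext r s
    rw [Matrix.mul_apply, Matrix.mul_apply]
    simp only [mul_diagonal, submatrix_apply, conjTranspose_apply, id, mul_ite, mul_one, mul_zero,
      ite_mul, zero_mul]
    rw [e.sum_comp (fun j : J => V r j.1 * star (V s j.1)), ← Finset.sum_filter,
      ← Finset.sum_subtype_eq_sum_filter]
    simp [J]
  refine ⟨Fintype.card J, V.submatrix id fun j => (e j).1, ?_, ?_⟩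
  · rw [conjTranspose_submatrix, ← submatrix_mul _ _ _ _ _ Function.bijective_id, hV]
    exact submatrix_one _ (Subtype.val_injective.comp e.injective)
  · rw [hW, hl, conj_diagonal_sub]
    refine norm_mul_diagonal_mul_le hV (by positivity) fun i => ?_
    have h1 := hlδ i
    have h2 : |l i * l i - l i| = |l i| * |1 - l i| := by
      rw [← abs_mul, ← abs_neg]; congr 1; ring
    split_ifs with hi
    · rw [← Complex.ofReal_one, ← Complex.ofReal_sub, Complex.norm_real, Real.norm_eq_abs]
      nlinarith [le_abs_self (l i), abs_nonneg (1 - l i)]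
    · rw [zero_sub, norm_neg, Complex.norm_real, Real.norm_eq_abs]
      nlinarith [le_abs_self (1 - l i), abs_nonneg (l i)]

lemma card_le_of_norm_mul_conjTranspose_sub_one {S : Matrix X Y ℂ} (h : ‖S * Sᴴ - 1‖ < 1) :
    Fintype.card X ≤ Fintype.card Y := by
  have hu : IsUnit (S * Sᴴ) := by
    have : ‖1 - S * Sᴴ‖ < 1 := by rwa [norm_sub_rev]
    have := isUnit_one_sub_of_norm_lt_one this
    rwa [sub_sub_cancel] at this
  calc Fintype.card X = (S * Sᴴ).rank := (rank_of_isUnit _ hu).symm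
    _ ≤ S.rank := rank_mul_le_left _ _
    _ ≤ Fintype.card Y := rank_le_card_width _

/-- An approximate unitary matrix is close to a unitary matrix. -/
lemma exists_unitary_near {S : Matrix X X ℂ} {δ : ℝ} (hδ : δ ≤ 1 / 2) (h : ‖Sᴴ * S - 1‖ ≤ δ) :
    ∃ U : Matrix X X ℂ, Uᴴ * U = 1 ∧ U * Uᴴ = 1 ∧ ‖U - S‖ ≤ δ := by
  have hh : IsSelfAdjoint (Sᴴ * S) := isHermitian_conjTranspose_mul_self S
  have hδ0 : 0 ≤ δ := (norm_nonneg _).trans h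
  obtain ⟨V, l, hV, hV', hl⟩ := exists_diagonalization hh
  have hone : V * diagonal (fun _ => (1 : ℂ)) * Vᴴ = 1 := by
    rw [diagonal_one, Matrix.mul_one, hV']
  have hlδ : ∀ i, |l i - 1| ≤ δ := fun i => by
    have := (norm_le_norm_mul_diagonal_mul hV (fun i => ((l i : ℂ) - 1)) i)
    rw [← conj_diagonal_sub, ← hl, hone] at this
    have h2 := this.trans h
    rwa [← Complex.ofReal_one, ← Complex.ofReal_sub, Complex.norm_real, Real.norm_eq_abs] at h2
  have hl0 : ∀ i, 0 < l i := fun i => by linarith [(abs_le.1 (hlδ i)).1]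
  -- `g` is `(Sᴴ * S) ^ (-1/2)`, so `S * g` is the unitary of the polar decomposition. Its distance
  -- to `S` is controlled by `|1 - √l| ≤ |1 - l|`.
  set g := V * diagonal (fun i => (((√(l i))⁻¹ : ℝ) : ℂ)) * Vᴴ with hg
  have hgs : gᴴ = g := by
    rw [hg, conjTranspose_mul, conjTranspose_mul, conjTranspose_conjTranspose,
      diagonal_conjTranspose, Matrix.mul_assoc]
    congr 3
    ext i
    simp
  have hU : (S * g)ᴴ * (S * g) = 1 := by
    have : (S * g)ᴴ * (S * g) = g * (Sᴴ * S) * g := by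
      rw [conjTranspose_mul, hgs]; simp only [Matrix.mul_assoc]
    rw [this, hl, hg, conj_diagonal_mul hV, conj_diagonal_mul hV, ← hone]
    congr 3
    ext i
    have := Real.mul_self_sqrt (hl0 i).le
    have h3 := Real.sqrt_pos.2 (hl0 i)
    rw [← Complex.ofReal_mul, ← Complex.ofReal_mul, ← Complex.ofReal_one]
    congr 1
    field_simp
    nlinarith
  have hU' := mul_eq_one_comm.1 hU
  refine ⟨S * g, hU, hU', ?_⟩
  have hgg : g * (V * diagonal (fun i => ((√(l i) : ℝ) : ℂ)) * Vᴴ) = 1 := by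
    rw [hg, conj_diagonal_mul hV, ← hone]
    congr 3
    ext i
    rw [← Complex.ofReal_mul, ← Complex.ofReal_one, inv_mul_cancel₀ (Real.sqrt_pos.2 (hl0 i)).ne']
  have hsub : S * g - S = S * g * (1 - V * diagonal (fun i => ((√(l i) : ℝ) : ℂ)) * Vᴴ) := by
    rw [Matrix.mul_sub, Matrix.mul_one, Matrix.mul_assoc S g, hgg, Matrix.mul_one]
  rw [hsub]
  have h1 : ‖1 - V * diagonal (fun i => ((√(l i) : ℝ) : ℂ)) * Vᴴ‖ ≤ δ := by
    rw [← hone, conj_diagonal_sub]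
    refine norm_mul_diagonal_mul_le hV hδ0 fun i => ?_
    rw [← Complex.ofReal_one, ← Complex.ofReal_sub, Complex.norm_real, Real.norm_eq_abs]
    refine le_trans ?_ (hlδ i)
    have h2 := Real.mul_self_sqrt (hl0 i).le
    have h3 := Real.sqrt_nonneg (l i)
    have h4 : |l i - 1| = |1 - √(l i)| * (1 + √(l i)) := by
      rw [← abs_of_nonneg (show 0 ≤ 1 + √(l i) by positivity), ← abs_mul, ← abs_neg]
      congr 1
      linear_combination h2
    rw [h4]
    nlinarith [abs_nonneg (1 - √(l i))]
  calc _ ≤ ‖S * g‖ * ‖1 - V * diagonal (fun i => ((√(l i) : ℝ) : ℂ)) * Vᴴ‖ := norm_mul_le _ _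
    _ ≤ 1 * δ := by
      gcongr
      exact norm_le_one_of_conjTranspose_mul_self hU
    _ = δ := one_mul δ

end Perturbation

/-! ### Block decompositions -/

section Blocks

open scoped Matrix.Norms.L2Operator
open Matrix

/-- The coordinate projections of a decomposition of `ℂ^X` into blocks of sizes `m a`. -/
def blockProj {I X : Type*} [DecidableEq X] {m : I → ℕ} (e : (Σ a, Fin (m a)) ≃ X) (a : I) :
    Matrix (Fin (m a)) X ℂ :=
  (1 : Matrix X X ℂ).submatrix (fun j => e ⟨a, j⟩) id

variable {I X Y : Type*} [DecidableEq X] {m : I → ℕ}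

/-- The block diagonal matrix with blocks `T a`. -/
def blockSum [Fintype I] (e : (Σ a, Fin (m a)) ≃ X) (T : ∀ a, Matrix (Fin (m a)) (Fin (m a)) ℂ) :
    Matrix X X ℂ :=
  ∑ a, (blockProj e a)ᴴ * T a * blockProj e a

/-- The matrix with blocks of columns `Z a`. -/
def blockRow [Fintype I] (e : (Σ a, Fin (m a)) ≃ X) (Z : ∀ a, Matrix Y (Fin (m a)) ℂ) : Matrix Y X ℂ :=
  ∑ a, Z a * blockProj e a

lemma blockProj_mul_conjTranspose_self [Fintype X] (e : (Σ a, Fin (m a)) ≃ X) (a : I) :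
    blockProj e a * (blockProj e a)ᴴ = 1 := by
  unfold blockProj
  rw [conjTranspose_submatrix, ← submatrix_mul _ _ _ _ _ Function.bijective_id,
    conjTranspose_one, Matrix.one_mul]
  exact submatrix_one _ (e.injective.comp sigma_mk_injective)

lemma blockProj_mul_conjTranspose_of_ne [Fintype X] (e : (Σ a, Fin (m a)) ≃ X) {a b : I} (h : a ≠ b) :
    blockProj e a * (blockProj e b)ᴴ = 0 := by
  unfold blockProj
  rw [conjTranspose_submatrix, ← submatrix_mul _ _ _ _ _ Function.bijective_id,
    conjTranspose_one, Matrix.one_mul]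
  ext i j
  rw [submatrix_apply, one_apply_ne]
  · rfl
  · intro h'
    exact h (congrArg Sigma.fst (e.injective h'))

lemma sum_conjTranspose_mul_blockProj [Fintype I] [Fintype X] (e : (Σ a, Fin (m a)) ≃ X) :
    ∑ a, (blockProj e a)ᴴ * blockProj e a = 1 := by
  ext x y
  rw [Matrix.sum_apply]
  simp only [Matrix.mul_apply]
  rw [← Fintype.sum_sigma' (fun a j => (blockProj e a)ᴴ x j * blockProj e a j y)]
  calc _ = ∑ p, star ((1 : Matrix X X ℂ) (e p) x) * (1 : Matrix X X ℂ) (e p) y := rfl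
    _ = ∑ z, ((1 : Matrix X X ℂ)ᴴ x z) * (1 : Matrix X X ℂ) z y :=
      e.sum_comp (fun z => star ((1 : Matrix X X ℂ) z x) * (1 : Matrix X X ℂ) z y)
    _ = (1 : Matrix X X ℂ) x y := by rw [← Matrix.mul_apply, conjTranspose_one, Matrix.one_mul]

lemma norm_blockProj_le [Fintype X] (e : (Σ a, Fin (m a)) ≃ X) (a : I) : ‖blockProj e a‖ ≤ 1 := by
  rw [← l2_opNorm_conjTranspose]
  exact norm_le_one_of_conjTranspose_mul_self
    (by rw [conjTranspose_conjTranspose, blockProj_mul_conjTranspose_self])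

lemma norm_mul_blockProj_le [Fintype X] [Fintype Y] (e : (Σ a, Fin (m a)) ≃ X) (a : I) (Z : Matrix Y (Fin (m a)) ℂ) :
    ‖Z * blockProj e a‖ ≤ ‖Z‖ :=
  (l2_opNorm_mul _ _).trans (mul_le_of_le_one_right (norm_nonneg _) (norm_blockProj_le e a))

lemma norm_conj_blockProj_le [Fintype X] (e : (Σ a, Fin (m a)) ≃ X) (a b : I)
    (Z : Matrix (Fin (m a)) (Fin (m b)) ℂ) :
    ‖(blockProj e a)ᴴ * Z * blockProj e b‖ ≤ ‖Z‖ := by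
  refine (norm_mul_blockProj_le e b _).trans ((l2_opNorm_mul _ _).trans ?_)
  rw [l2_opNorm_conjTranspose]
  exact mul_le_of_le_one_left (norm_nonneg _) (norm_blockProj_le e a)

/-- The triangle inequality is wasteful here, but the factor `card I` does not depend on the matrix
size. -/
lemma norm_blockSum_le [Fintype I] [Fintype X] (e : (Σ a, Fin (m a)) ≃ X)
    {T : ∀ a, Matrix (Fin (m a)) (Fin (m a)) ℂ} {c : ℝ} (hT : ∀ a, ‖T a‖ ≤ c) :
    ‖blockSum e T‖ ≤ Fintype.card I * c := by
  unfold blockSum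
  refine (norm_sum_le_of_le _ fun a _ => (norm_conj_blockProj_le e a a (T a)).trans (hT a)).trans ?_
  simp

lemma blockSum_sub [Fintype I] (e : (Σ a, Fin (m a)) ≃ X) (T T' : ∀ a, Matrix (Fin (m a)) (Fin (m a)) ℂ) :
    blockSum e T - blockSum e T' = blockSum e fun a => T a - T' a := by
  simp only [blockSum, Matrix.mul_sub, Matrix.sub_mul, Finset.sum_sub_distrib]

lemma blockRow_mul_blockSum [Fintype I] [Fintype X] [Fintype Y] (e : (Σ a, Fin (m a)) ≃ X) (Z : ∀ a, Matrix Y (Fin (m a)) ℂ)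
    (T : ∀ a, Matrix (Fin (m a)) (Fin (m a)) ℂ) :
    blockRow e Z * blockSum e T = blockRow e fun a => Z a * T a := by
  classical
  unfold blockRow blockSum
  rw [Matrix.sum_mul]
  refine Finset.sum_congr rfl fun a _ => ?_
  rw [Matrix.mul_sum, Finset.sum_eq_single a]
  · calc _ = Z a * (blockProj e a * (blockProj e a)ᴴ) * T a * blockProj e a := by
          simp only [Matrix.mul_assoc]
      _ = _ := by rw [blockProj_mul_conjTranspose_self, Matrix.mul_one]
  · intro b _ hb
    calc _ = Z a * (blockProj e a * (blockProj e b)ᴴ) * T b * blockProj e b := by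
          simp only [Matrix.mul_assoc]
      _ = _ := by simp [blockProj_mul_conjTranspose_of_ne e hb.symm]
  · simp

lemma norm_blockRow_le [Fintype I] [Fintype X] [Fintype Y] (e : (Σ a, Fin (m a)) ≃ X) {Z : ∀ a, Matrix Y (Fin (m a)) ℂ} {c : ℝ}
    (hZ : ∀ a, ‖Z a‖ ≤ c) : ‖blockRow e Z‖ ≤ Fintype.card I * c := by
  unfold blockRow
  refine (norm_sum_le_of_le _ fun a _ => (norm_mul_blockProj_le e a (Z a)).trans (hZ a)).trans ?_
  simp

lemma norm_mul_blockRow_sub_le [Fintype I] [Fintype X] [Fintype Y] (e : (Σ a, Fin (m a)) ≃ X) {Z : ∀ a, Matrix Y (Fin (m a)) ℂ}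
    {T : ∀ a, Matrix (Fin (m a)) (Fin (m a)) ℂ} {A : Matrix Y Y ℂ} {c : ℝ}
    (h : ∀ a, ‖A * Z a - Z a * T a‖ ≤ c) :
    ‖A * blockRow e Z - blockRow e Z * blockSum e T‖ ≤ Fintype.card I * c := by
  have : A * blockRow e Z - blockRow e Z * blockSum e T =
      blockRow e fun a => A * Z a - Z a * T a := by
    rw [blockRow_mul_blockSum]
    unfold blockRow
    rw [Matrix.mul_sum, ← Finset.sum_sub_distrib]
    exact Finset.sum_congr rfl fun a _ => by simp only [Matrix.sub_mul, Matrix.mul_assoc]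
  rw [this]
  exact norm_blockRow_le e h

lemma blockRow_mul_conjTranspose [Fintype I] [Fintype X] [Fintype Y] (e : (Σ a, Fin (m a)) ≃ X) (Z : ∀ a, Matrix Y (Fin (m a)) ℂ) :
    blockRow e Z * (blockRow e Z)ᴴ = ∑ a, Z a * (Z a)ᴴ := by
  classical
  unfold blockRow
  rw [conjTranspose_sum, Matrix.sum_mul]
  refine Finset.sum_congr rfl fun a _ => ?_
  rw [Matrix.mul_sum, Finset.sum_eq_single a]
  · calc _ = Z a * (blockProj e a * (blockProj e a)ᴴ) * (Z a)ᴴ := by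
          simp only [Matrix.mul_assoc, conjTranspose_mul]
      _ = _ := by rw [blockProj_mul_conjTranspose_self, Matrix.mul_one]
  · intro b _ hb
    calc _ = Z a * (blockProj e a * (blockProj e b)ᴴ) * (Z b)ᴴ := by
          simp only [Matrix.mul_assoc, conjTranspose_mul]
      _ = _ := by simp [blockProj_mul_conjTranspose_of_ne e hb.symm]
  · simp

lemma norm_conjTranspose_mul_blockRow_sub_one_le [Fintype I] [Fintype X] [Fintype Y] (e : (Σ a, Fin (m a)) ≃ X)
    {Z : ∀ a, Matrix Y (Fin (m a)) ℂ} {c : ℝ} (h1 : ∀ a, ‖(Z a)ᴴ * Z a - 1‖ ≤ c)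
    (h2 : ∀ a b, a ≠ b → ‖(Z a)ᴴ * Z b‖ ≤ c) :
    ‖(blockRow e Z)ᴴ * blockRow e Z - 1‖ ≤ Fintype.card I * (Fintype.card I * c) := by
  classical
  have : (blockRow e Z)ᴴ * blockRow e Z - 1 =
      ∑ a, ((blockProj e a)ᴴ * ((Z a)ᴴ * Z a - 1) * blockProj e a +
        ∑ b ∈ Finset.univ.erase a, (blockProj e a)ᴴ * ((Z a)ᴴ * Z b) * blockProj e b) := by
    rw [← sum_conjTranspose_mul_blockProj e]
    unfold blockRow
    rw [conjTranspose_sum, Matrix.sum_mul, ← Finset.sum_sub_distrib]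
    refine Finset.sum_congr rfl fun a _ => ?_
    rw [Matrix.mul_sum, ← Finset.add_sum_erase _ _ (Finset.mem_univ a), add_sub_right_comm]
    congr 1
    · simp only [Matrix.mul_sub, Matrix.sub_mul, Matrix.mul_assoc, conjTranspose_mul,
        Matrix.one_mul]
    · exact Finset.sum_congr rfl fun b _ => by simp only [Matrix.mul_assoc, conjTranspose_mul]
  rw [this]
  have key : ∀ a, ‖(blockProj e a)ᴴ * ((Z a)ᴴ * Z a - 1) * blockProj e a +
      ∑ b ∈ Finset.univ.erase a, (blockProj e a)ᴴ * ((Z a)ᴴ * Z b) * blockProj e b‖ ≤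
      Fintype.card I * c := by
    intro a
    have g1 := (norm_conj_blockProj_le e a a _).trans (h1 a)
    have g2 := norm_sum_le_of_le (Finset.univ.erase a) (f := fun b =>
      (blockProj e a)ᴴ * ((Z a)ᴴ * Z b) * blockProj e b) (n := fun _ => c) fun b hb =>
        (norm_conj_blockProj_le e a b _).trans (h2 a b (Finset.ne_of_mem_erase hb).symm)
    have g3 := norm_add_le ((blockProj e a)ᴴ * ((Z a)ᴴ * Z a - 1) * blockProj e a)
      (∑ b ∈ Finset.univ.erase a, (blockProj e a)ᴴ * ((Z a)ᴴ * Z b) * blockProj e b)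
    have g4 : c + ∑ b ∈ Finset.univ.erase a, c = ∑ b : I, c :=
      Finset.add_sum_erase _ (fun _ => c) (Finset.mem_univ a)
    have g5 : ∑ b : I, c = Fintype.card I * c := by simp
    linarith
  refine (norm_sum_le_of_le _ fun a _ => key a).trans ?_
  simp

end Blocks

/-! ### Approximate block diagonalization -/

section BlockDiagonalization

open scoped Matrix.Norms.L2Operator
open Matrix

variable {I X : Type*} [Fintype I] [Fintype X] [DecidableEq X] {β : I → I} {v : I → Matrix X X ℂ}
  {ε : ℝ}

/-- For exact relations, multiplying `∑ c, v c * star (v c) = 1` by `v a` leaves only the term `c =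
a`, so `v a` is a partial isometry. -/
lemma IsApproxColumnSystem.norm_mul_star_mul_sub_le (hv : IsApproxColumnSystem β v ε) (a : I) :
    ‖v a * (star (v a) * v a) - v a‖ ≤ 2 * (Fintype.card I + 1) * ε := by
  classical
  have hε : 0 < ε := (norm_nonneg _).trans_lt hv.sum
  have h1 : v a * (star (v a) * v a) - v a = (∑ c, v c * star (v c) - 1) * v a -
      ∑ c ∈ Finset.univ.erase a, v c * (star (v c) * v a) := by
    rw [sub_mul, one_mul, Finset.sum_mul, ← Finset.add_sum_erase _ _ (Finset.mem_univ a)]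
    simp only [mul_assoc]
    abel
  have h2 : ‖(∑ c, v c * star (v c) - 1) * v a‖ ≤ ε * 2 :=
    norm_mul_le_of_le hv.sum.le (hv.norm_lt a).le
  have h3 : ‖∑ c ∈ Finset.univ.erase a, v c * (star (v c) * v a)‖ ≤ Fintype.card I * (2 * ε) := by
    refine (norm_sum_le_of_le _ fun c hc => norm_mul_le_of_le (hv.norm_lt c).le
      (hv.orth c a (Finset.ne_of_mem_erase hc)).le).trans ?_
    rw [Finset.sum_const, nsmul_eq_mul]
    gcongr
    exact Finset.card_le_univ _
  rw [h1]
  refine (norm_sub_le _ _).trans ?_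
  linarith

lemma IsApproxColumnSystem.norm_sq_sub_le (hv : IsApproxColumnSystem β v ε) (a : I) :
    ‖star (v a) * v a * (star (v a) * v a) - star (v a) * v a‖ ≤
      4 * (Fintype.card I + 1) * ε := by
  have : star (v a) * v a * (star (v a) * v a) - star (v a) * v a =
      star (v a) * (v a * (star (v a) * v a) - v a) := by
    rw [mul_sub]; simp only [mul_assoc]
  rw [this]
  have h2 : ‖star (v a)‖ ≤ 2 := by rw [norm_star]; exact (hv.norm_lt a).le
  refine (norm_mul_le_of_le h2 (hv.norm_mul_star_mul_sub_le a)).trans (le_of_eq ?_)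
  ring

/-- Only the representatives `β b = b` get an initial space; size 0 elsewhere makes `∑ b, m b` count
each distinct block once. -/
lemma IsApproxColumnSystem.exists_isometries (hv : IsApproxColumnSystem β v ε) :
    ∃ (m : I → ℕ) (W : ∀ b, Matrix X (Fin (m b)) ℂ), (∀ b, β b ≠ b → m b = 0) ∧
      (∀ b, (W b)ᴴ * W b = 1) ∧
      ∀ b, β b = b → ‖W b * (W b)ᴴ - star (v b) * v b‖ ≤ 8 * (Fintype.card I + 1) * ε := by
  have : ∀ b, ∃ (m : ℕ) (W : Matrix X (Fin m) ℂ), (β b ≠ b → m = 0) ∧ Wᴴ * W = 1 ∧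
      (β b = b → ‖W * Wᴴ - star (v b) * v b‖ ≤ 8 * (Fintype.card I + 1) * ε) := by
    intro b
    by_cases hb : β b = b
    · obtain ⟨m, W, h1, h2⟩ := exists_isometry_near (IsSelfAdjoint.star_mul_self (v b))
        (hv.norm_sq_sub_le b)
      exact ⟨m, W, fun h => absurd hb h, h1, fun _ => h2.trans (le_of_eq (by ring))⟩
    · exact ⟨0, 0, fun _ => rfl, Subsingleton.elim _ _, fun h => absurd h hb⟩
  choose m W h1 h2 h3 using this
  exact ⟨m, W, h1, h2, h3⟩

/-- Matrices that almost commute with an approximate column system are simultaneously close to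
block diagonal matrices whose blocks are repeated according to `β`. -/
theorem exists_blockSum_near (hβ : ∀ a, β (β a) = β a) {R η : ℝ} (hR : 0 ≤ R) (hη : 0 < η) :
    ∃ ε > 0, ∀ {k : ℕ} {v : I → Matrix (Fin k) (Fin k) ℂ}, IsApproxColumnSystem β v ε →
      ∃ m : I → ℕ, (∀ b, β b ≠ b → m b = 0) ∧ Nonempty ((Σ a, Fin (m (β a))) ≃ Fin k) ∧
        ∀ e : (Σ a, Fin (m (β a))) ≃ Fin k, ∃ U : Matrix (Fin k) (Fin k) ℂ, Uᴴ * U = 1 ∧ U * Uᴴ = 1 ∧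
          ∀ A : Matrix (Fin k) (Fin k) ℂ, IsSelfAdjoint A → ‖A‖ ≤ R →
            (∀ b, ‖A * v b - v b * A‖ < ε) →
            ∃ T : ∀ b, Matrix (Fin (m b)) (Fin (m b)) ℂ, (∀ b, IsSelfAdjoint (T b)) ∧
              (∀ b, ‖T b‖ ≤ R) ∧ ‖A - U * blockSum e (fun a => T (β a)) * Uᴴ‖ ≤ η := by
  set c : ℝ := ((Fintype.card I : ℕ) : ℝ) with hc
  have hc0 : 0 ≤ c := by positivity
  -- The summands serve, in order: `SᴴS ≈ 1`, `SSᴴ ≈ 1`, replacing `S` by `U`, and `A * S ≈ S * D`,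
  -- where `S = blockRow e Z` and `D` is the block diagonal matrix.
  set K : ℝ := 5 * c * c + 20 * c + 2 + (1 + c) * R * (5 * c * c) + c * (1 + 10 * R) with hK
  have hK0 : 0 < K := by positivity
  set κ : ℝ := min (1 / 2) η / K with hκ
  have hκ0 : 0 < κ := by positivity
  have hκK : κ * K = min (1 / 2) η := by rw [hκ]; field_simp
  set ε : ℝ := κ / (2 * (c + 1)) with hε
  have hε0 : 0 < ε := by positivity
  have hεκ : 2 * (c + 1) * ε = κ := by rw [hε]; field_simp
  have hε2 : 2 * ε ≤ κ := by nlinarith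
  refine ⟨ε, hε0, fun {k v} hv => ?_⟩
  obtain ⟨m, W, hm, hW, hWv⟩ := hv.exists_isometries
  have hv2 : ∀ a, ‖v a‖ ≤ 2 := fun a => (hv.norm_lt a).le
  have hv2' : ∀ a, ‖star (v a)‖ ≤ 2 := fun a => by rw [norm_star]; exact hv2 a
  have hW1 : ∀ b, ‖W b‖ ≤ 1 := fun b => norm_le_one_of_conjTranspose_mul_self (hW b)
  have hW1' : ∀ b, ‖(W b)ᴴ‖ ≤ 1 := fun b => by rw [l2_opNorm_conjTranspose]; exact hW1 b
  have hq : ∀ a, ‖W (β a) * (W (β a))ᴴ - star (v (β a)) * v (β a)‖ ≤ 4 * κ := fun a =>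
    (hWv (β a) (hβ a)).trans (le_of_eq (by rw [← hεκ]; ring))
  have hvq : ∀ a, ‖v a * (W (β a) * (W (β a))ᴴ) - v a‖ ≤ 10 * κ := by
    intro a
    have e1 : v a * (W (β a) * (W (β a))ᴴ) - v a =
        v a * (W (β a) * (W (β a))ᴴ - star (v (β a)) * v (β a)) -
        v a * (star (v a) * v a - star (v (β a)) * v (β a)) +
        (v a * (star (v a) * v a) - v a) := by
      noncomm_ring
    have e2 := norm_mul_le_of_le (hv2 a) (hq a)
    have e3 := norm_mul_le_of_le (hv2 a) (hv.init a).le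
    have e4 := hv.norm_mul_star_mul_sub_le a
    rw [e1]
    refine (norm_add_le _ _).trans ?_
    have e5 := norm_sub_le (v a * (W (β a) * (W (β a))ᴴ - star (v (β a)) * v (β a)))
      (v a * (star (v a) * v a - star (v (β a)) * v (β a)))
    rw [← hc, hεκ] at e4
    linarith
  -- `Z a` carries the common initial space of its group almost isometrically onto the range of `v
  -- a`.
  set Z : ∀ a, Matrix (Fin k) (Fin (m (β a))) ℂ := fun a => v a * W (β a) with hZ
  have hZ1 : ∀ a, ‖(Z a)ᴴ * Z a - 1‖ ≤ 5 * κ := by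
    intro a
    have e1 : (Z a)ᴴ * Z a - 1 = (W (β a))ᴴ * ((star (v a) * v a - star (v (β a)) * v (β a)) -
        (W (β a) * (W (β a))ᴴ - star (v (β a)) * v (β a))) * W (β a) := by
      have : (W (β a))ᴴ * (W (β a) * (W (β a))ᴴ) * W (β a) = 1 := by
        rw [← Matrix.mul_assoc, hW, Matrix.one_mul, hW]
      rw [sub_sub_sub_cancel_right, Matrix.mul_sub, Matrix.sub_mul, this, hZ]
      simp only [conjTranspose_mul, Matrix.mul_assoc, star_eq_conjTranspose]
    have e2 := norm_sub_le (star (v a) * v a - star (v (β a)) * v (β a))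
      (W (β a) * (W (β a))ᴴ - star (v (β a)) * v (β a))
    have e3 : ‖(star (v a) * v a - star (v (β a)) * v (β a)) -
        (W (β a) * (W (β a))ᴴ - star (v (β a)) * v (β a))‖ ≤ 5 * κ := by
      linarith [hv.init a, hq a]
    rw [e1]
    calc _ ≤ _ := l2_opNorm_mul _ _
      _ ≤ _ := mul_le_mul_of_nonneg_right (l2_opNorm_mul _ _) (norm_nonneg _)
      _ ≤ 1 * (5 * κ) * 1 := by
        gcongr
        · exact hW1' _
        · exact hW1 _
      _ = _ := by ring
  have hZ2 : ∀ a b, a ≠ b → ‖(Z a)ᴴ * Z b‖ ≤ 5 * κ := by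
    intro a b hab
    have e1 : (Z a)ᴴ * Z b = (W (β a))ᴴ * (star (v a) * v b) * W (β b) := by
      rw [hZ]
      simp only [conjTranspose_mul, Matrix.mul_assoc, star_eq_conjTranspose]
    rw [e1]
    calc _ ≤ _ := l2_opNorm_mul _ _
      _ ≤ _ := mul_le_mul_of_nonneg_right (l2_opNorm_mul _ _) (norm_nonneg _)
      _ ≤ 1 * ε * 1 := by
        gcongr
        · exact hW1' _
        · exact (hv.orth a b hab).le
        · exact hW1 _
      _ ≤ _ := by linarith
  have hZs : ‖∑ a, Z a * (Z a)ᴴ - 1‖ < 1 := by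
    have e1 : ∑ a, Z a * (Z a)ᴴ - 1 =
        ∑ a, (v a * (W (β a) * (W (β a))ᴴ) - v a) * star (v a) +
          (∑ a, v a * star (v a) - 1) := by
      rw [← add_sub_assoc, ← Finset.sum_add_distrib]
      congr 1
      refine Finset.sum_congr rfl fun a _ => ?_
      rw [hZ, sub_mul, sub_add_cancel]
      simp only [conjTranspose_mul, Matrix.mul_assoc, star_eq_conjTranspose]
    have e2 : ‖∑ a, (v a * (W (β a) * (W (β a))ᴴ) - v a) * star (v a)‖ ≤ c * (10 * κ * 2) := by
      refine (norm_sum_le_of_le _ fun a _ => norm_mul_le_of_le (hvq a) (hv2' a)).trans ?_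
      simp [hc]
    rw [e1]
    refine (norm_add_le _ _).trans_lt ?_
    have e3 : κ * (20 * c + 1) ≤ κ * K := by
      refine mul_le_mul_of_nonneg_left ?_ hκ0.le
      rw [hK]
      have : 0 ≤ 5 * c * c + (1 + c) * R * (5 * c * c) + c * (1 + 10 * R) := by positivity
      linarith
    have e4 := min_le_left (1 / 2) η
    linarith [hv.sum]
  have hSS : ∀ {Y : Type} [Fintype Y] [DecidableEq Y] (e : (Σ a, Fin (m (β a))) ≃ Y),
      ‖(blockRow e Z)ᴴ * blockRow e Z - 1‖ ≤ 5 * c * c * κ := fun e =>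
    (norm_conjTranspose_mul_blockRow_sub_one_le e hZ1 hZ2).trans (le_of_eq (by rw [← hc]; ring))
  have hcK : 5 * c * c * κ ≤ 1 / 2 := by
    have e3 : κ * (5 * c * c) ≤ κ * K := by
      refine mul_le_mul_of_nonneg_left ?_ hκ0.le
      rw [hK]
      have : 0 ≤ 20 * c + 2 + (1 + c) * R * (5 * c * c) + c * (1 + 10 * R) := by positivity
      linarith
    linarith [min_le_left (1 / 2) η]
  -- Both `SSᴴ` and `SᴴS` are invertible, so comparing ranks forces the block sizes to add up to
  -- exactly `k`.
  have hcard : Fintype.card (Σ a, Fin (m (β a))) = k := by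
    obtain ⟨n, ⟨f⟩⟩ : ∃ n, Nonempty ((Σ a, Fin (m (β a))) ≃ Fin n) :=
      ⟨_, ⟨Fintype.equivFin _⟩⟩
    have e1 : Fintype.card (Fin k) ≤ Fintype.card (Fin n) := by
      refine card_le_of_norm_mul_conjTranspose_sub_one (S := blockRow f Z) ?_
      rw [blockRow_mul_conjTranspose]
      exact hZs
    have e2 : Fintype.card (Fin n) ≤ Fintype.card (Fin k) := by
      refine card_le_of_norm_mul_conjTranspose_sub_one (S := (blockRow f Z)ᴴ) ?_
      rw [conjTranspose_conjTranspose]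
      linarith [hSS f]
    rw [Fintype.card_congr f]
    simpa using le_antisymm e2 e1
  refine ⟨m, hm, ⟨Fintype.equivFinOfCardEq hcard⟩, fun e => ?_⟩
  obtain ⟨U, hU, hU', hUS⟩ := exists_unitary_near hcK (hSS e)
  refine ⟨U, hU, hU', fun A hA hAR hAv => ?_⟩
  -- Compression of `A` to the initial space. Since `A * v a ≈ v a * A`, one gets `A * Z a ≈ Z a * T
  -- (β a)`, the same block throughout a group.
  set T : ∀ b, Matrix (Fin (m b)) (Fin (m b)) ℂ := fun b => (W b)ᴴ * A * W b with hT
  have hTs : ∀ b, IsSelfAdjoint (T b) := by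
    intro b
    have hA' : Aᴴ = A := hA
    change ((W b)ᴴ * A * W b)ᴴ = (W b)ᴴ * A * W b
    rw [conjTranspose_mul, conjTranspose_mul, hA', conjTranspose_conjTranspose, Matrix.mul_assoc]
  have hTR : ∀ b, ‖T b‖ ≤ R := by
    intro b
    calc _ ≤ _ := l2_opNorm_mul _ _
      _ ≤ _ := mul_le_mul_of_nonneg_right (l2_opNorm_mul _ _) (norm_nonneg _)
      _ ≤ 1 * R * 1 := by
        gcongr
        · exact hW1' _
        · exact hW1 _
      _ = R := by ring
  refine ⟨T, hTs, hTR, ?_⟩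
  set D := blockSum e (fun a => T (β a)) with hD
  have hDR : ‖D‖ ≤ c * R := norm_blockSum_le e fun a => hTR (β a)
  have hAS : ‖A * blockRow e Z - blockRow e Z * D‖ ≤ c * (κ + 10 * κ * R) := by
    refine norm_mul_blockRow_sub_le e fun a => ?_
    have e1 : A * Z a - Z a * T (β a) = ((A * v a - v a * A) -
        (v a * (W (β a) * (W (β a))ᴴ) - v a) * A) * W (β a) := by
      rw [hZ, hT]
      simp only [Matrix.sub_mul, Matrix.mul_assoc]
      abel
    have e2 := norm_sub_le (A * v a - v a * A) ((v a * (W (β a) * (W (β a))ᴴ) - v a) * A)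
    have e3 := norm_mul_le_of_le (hvq a) hAR
    have e4 := hAv a
    rw [e1]
    refine (l2_opNorm_mul _ _).trans ((mul_le_of_le_one_right (norm_nonneg _) (hW1 _)).trans ?_)
    linarith
  have h1 : ‖U‖ ≤ 1 := norm_le_one_of_conjTranspose_mul_self hU
  have h1' : ‖Uᴴ‖ ≤ 1 := by rwa [l2_opNorm_conjTranspose]
  have h2 : A - U * D * Uᴴ = (A * (U - blockRow e Z) + (A * blockRow e Z - blockRow e Z * D) -
      (U - blockRow e Z) * D) * Uᴴ := by
    have : A = A * U * Uᴴ := by rw [Matrix.mul_assoc, hU', Matrix.mul_one]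
    conv_lhs => rw [this]
    simp only [Matrix.sub_mul, Matrix.mul_sub, Matrix.add_mul]
    abel
  rw [h2]
  refine (norm_mul_le_of_le le_rfl h1').trans ?_
  rw [mul_one]
  have h3 := norm_sub_le (A * (U - blockRow e Z) + (A * blockRow e Z - blockRow e Z * D))
    ((U - blockRow e Z) * D)
  have h4 := norm_add_le (A * (U - blockRow e Z)) (A * blockRow e Z - blockRow e Z * D)
  have h5 := norm_mul_le_of_le hAR hUS
  have h6 := norm_mul_le_of_le hUS hDR
  have h7 : κ * ((1 + c) * R * (5 * c * c) + c * (1 + 10 * R)) ≤ κ * K := by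
    refine mul_le_mul_of_nonneg_left ?_ hκ0.le
    rw [hK]
    have : 0 ≤ 5 * c * c + 20 * c + 2 := by positivity
    linarith
  have h8 := min_le_right (1 / 2) η
  linarith

end BlockDiagonalization

/-! ### Covering balls in finite-dimensional normed spaces -/

section Covering

open MeasureTheory Metric Module
open scoped ENNReal

variable {E : Type*} [NormedAddCommGroup E] [NormedSpace ℝ E] [FiniteDimensional ℝ E]

/-- The balls of radius `ω / 2` around the points are disjoint and lie in the ball of radius `R + ω
/ 2`; compare volumes. -/
lemma card_le_of_separated (s : Finset E) {R ω : ℝ} (hR : 0 ≤ R) (hω : 0 < ω)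
    (hs : ∀ c ∈ s, ‖c‖ ≤ R) (h : ∀ c ∈ s, ∀ d ∈ s, c ≠ d → ω ≤ dist c d) :
    (s.card : ℝ) ≤ (1 + 2 * R / ω) ^ finrank ℝ E := by
  borelize E
  let μ : Measure E := Measure.addHaar
  have hω2 : 0 < ω / 2 := by positivity
  have hρ : 0 < R + ω / 2 := by positivity
  have D : Set.Pairwise (s : Set E) (Function.onFun Disjoint fun c => ball (c : E) (ω / 2)) := by
    rintro c hc d hd hcd
    apply ball_disjoint_ball
    linarith [h c hc d hd hcd]
  have hsub : (⋃ c ∈ s, ball (c : E) (ω / 2)) ⊆ ball (0 : E) (R + ω / 2) := by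
    refine Set.iUnion₂_subset fun x hx => ball_subset_ball' ?_
    rw [dist_zero_right]
    linarith [hs x hx]
  have h1 : (s.card : ℝ≥0∞) * ENNReal.ofReal ((ω / 2) ^ finrank ℝ E) * μ (ball 0 1) ≤
      ENNReal.ofReal ((R + ω / 2) ^ finrank ℝ E) * μ (ball 0 1) :=
    calc _ = μ (⋃ c ∈ s, ball (c : E) (ω / 2)) := by
          rw [measure_biUnion_finset D fun c _ => measurableSet_ball]
          simp only [μ.addHaar_ball_of_pos _ hω2]
          simp only [Finset.sum_const, nsmul_eq_mul, mul_assoc]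
      _ ≤ μ (ball (0 : E) (R + ω / 2)) := measure_mono hsub
      _ = _ := by simp only [μ.addHaar_ball_of_pos _ hρ]
  have h2 : (s.card : ℝ≥0∞) * ENNReal.ofReal ((ω / 2) ^ finrank ℝ E) ≤
      ENNReal.ofReal ((R + ω / 2) ^ finrank ℝ E) :=
    (ENNReal.mul_le_mul_iff_left (measure_ball_pos _ _ zero_lt_one).ne' measure_ball_lt_top.ne).1 h1
  have h3 := ENNReal.toReal_le_of_le_ofReal (pow_nonneg hρ.le _) h2
  rw [ENNReal.toReal_mul, ENNReal.toReal_natCast, ENNReal.toReal_ofReal (by positivity)] at h3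
  have h4 : 1 + 2 * R / ω = (R + ω / 2) / (ω / 2) := by field_simp; ring
  rw [h4, div_pow, le_div_iff₀ (by positivity)]
  exact h3

/-- A separated set of maximal cardinality is a net. -/
lemma exists_finset_cover_closedBall {R ω : ℝ} (hR : 0 ≤ R) (hω : 0 < ω) :
    ∃ s : Finset E, (∀ c ∈ s, ‖c‖ ≤ R) ∧ (∀ z : E, ‖z‖ ≤ R → ∃ c ∈ s, dist z c < ω) ∧
      (s.card : ℝ) ≤ (1 + 2 * R / ω) ^ finrank ℝ E := by
  classical
  let P : Finset E → Prop := fun s =>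
    (∀ c ∈ s, ‖c‖ ≤ R) ∧ ∀ c ∈ s, ∀ d ∈ s, c ≠ d → ω ≤ dist c d
  have hbdd : BddAbove {N : ℕ | ∃ s, P s ∧ s.card = N} := by
    refine ⟨⌊(1 + 2 * R / ω) ^ finrank ℝ E⌋₊, ?_⟩
    rintro _ ⟨s, hs, rfl⟩
    exact Nat.le_floor (card_le_of_separated s hR hω hs.1 hs.2)
  have hne : {N : ℕ | ∃ s, P s ∧ s.card = N}.Nonempty := ⟨0, ∅, ⟨by simp, by simp⟩, rfl⟩
  obtain ⟨s, hs, hcard⟩ := Nat.sSup_mem hne hbdd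
  refine ⟨s, hs.1, fun z hz => ?_, card_le_of_separated s hR hω hs.1 hs.2⟩
  by_contra! hcon
  have hzs : z ∉ s := fun h => by
    have := hcon z h
    rw [dist_self] at this
    linarith
  have hP : P (insert z s) := by
    refine ⟨fun c hc => ?_, fun c hc d hd hcd => ?_⟩
    · rcases Finset.mem_insert.1 hc with rfl | hc
      · exact hz
      · exact hs.1 c hc
    · rcases Finset.mem_insert.1 hc with hc' | hc' <;> rcases Finset.mem_insert.1 hd with hd' | hd'
      · exact absurd (hc'.trans hd'.symm) hcd
      · exact hc' ▸ hcon d hd'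
      · rw [dist_comm]; exact hd' ▸ hcon c hc'
      · exact hs.2 c hc' d hd' hcd
  have := le_csSup hbdd ⟨_, hP, rfl⟩
  rw [Finset.card_insert_of_notMem hzs] at this
  omega

end Covering

/-! ### Self-adjoint elements and unitaries -/

section SelfAdjoint

open Module Complex

/-- The real normed space of self-adjoint elements of a C*-algebra. -/
abbrev SelfAdjointSpace (B : Type*) [CStarAlgebra B] : Submodule ℝ B := selfAdjoint.submodule ℝ B

variable {B : Type*} [CStarAlgebra B]

lemma SelfAdjointSpace.isSelfAdjoint (b : SelfAdjointSpace B) : IsSelfAdjoint (b : B) := b.2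

/-- The map `(x, y) ↦ x + i y` is injective on pairs of self-adjoint elements. Counting `k ^ 2` real
parameters for the unitary, not `2 * k ^ 2`, is what makes the final bound 1. -/
lemma finrank_selfAdjointSpace_le [FiniteDimensional ℂ B] :
    finrank ℝ (SelfAdjointSpace B) ≤ finrank ℂ B := by
  have : FiniteDimensional ℝ B := FiniteDimensional.complexToReal B
  let I' : B →ₗ[ℝ] B := (LinearMap.lsmul ℂ B I).restrictScalars ℝ
  let f : (SelfAdjointSpace B × SelfAdjointSpace B) →ₗ[ℝ] B :=
    LinearMap.coprod (SelfAdjointSpace B).subtype (I' ∘ₗ (SelfAdjointSpace B).subtype)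
  have hf : ∀ x y, f (x, y) = x + I • (y : B) := fun x y => rfl
  have hinj : Function.Injective f := by
    rw [injective_iff_map_eq_zero]
    rintro ⟨x, y⟩ h
    rw [hf] at h
    have h' := congrArg star h
    rw [star_add, star_smul, (SelfAdjointSpace.isSelfAdjoint x).star_eq,
      (SelfAdjointSpace.isSelfAdjoint y).star_eq, star_zero,
      ← starRingEnd_apply, conj_I, neg_smul] at h'
    have hx : (x : B) = 0 := by
      have : (2 : ℂ) • (x : B) = 0 := by
        rw [two_smul]
        calc (x : B) + x = (x + I • (y : B)) + (x + -(I • (y : B))) := by abel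
          _ = 0 := by rw [h, h', add_zero]
      exact (smul_eq_zero.1 this).resolve_left two_ne_zero
    have hy : (y : B) = 0 := by
      rw [hx, zero_add] at h
      exact (smul_eq_zero.1 h).resolve_left I_ne_zero
    ext
    · exact hx
    · exact hy
  have h1 := LinearMap.finrank_le_finrank_of_injective hinj
  rw [finrank_prod, finrank_real_of_complex] at h1
  omega

/-- The unitary `exp (i b)`. -/
def expI (b : B) : B := NormedSpace.exp (I • b)

lemma expI_mem_unitary {b : B} (hb : IsSelfAdjoint b) : expI b ∈ unitary B :=
  (selfAdjoint.expUnitary ⟨b, hb⟩).2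

lemma norm_le_one_of_mem_unitary {u : B} (hu : u ∈ unitary B) : ‖u‖ ≤ 1 := by
  have h := CStarRing.norm_star_mul_self (x := u)
  rw [Unitary.star_mul_self_of_mem hu] at h
  nlinarith [norm_one_le_one (A := B), norm_nonneg u]

/-- The path `exp (i t b) * exp (i (1 - t) c)` joins the two unitaries, and its derivative is `i (b
- c)` between two unitaries. -/
lemma norm_expI_sub_le {b c : B} (hb : IsSelfAdjoint b) (hc : IsSelfAdjoint c) :
    ‖expI b - expI c‖ ≤ ‖b - c‖ := by
  let f : ℝ → B := fun t =>
    NormedSpace.exp (t • (I • b)) * NormedSpace.exp ((1 - t) • (I • c))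
  have hd : ∀ t, HasDerivAt f (NormedSpace.exp (t • (I • b)) * (I • (b - c)) *
      NormedSpace.exp ((1 - t) • (I • c))) t := by
    intro t
    have h1 := hasDerivAt_exp_smul_const (𝕂 := ℝ) (I • b) t
    have h2 := (hasDerivAt_exp_smul_const' (𝕂 := ℝ) (I • c) (1 - t)).scomp t
      ((hasDerivAt_id t).const_sub 1)
    convert h1.mul h2 using 1
    · rfl
    · simp only [smul_sub, mul_sub, sub_mul, neg_smul, one_smul, mul_neg, Function.comp, mul_assoc]
      abel
  have hu : ∀ (t : ℝ) {b : B}, IsSelfAdjoint b → ‖NormedSpace.exp (t • (I • b))‖ ≤ 1 := by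
    intro t b hb
    rw [smul_comm]
    exact norm_le_one_of_mem_unitary (expI_mem_unitary ((IsSelfAdjoint.all t).smul hb))
  have h := norm_image_sub_le_of_norm_deriv_le_segment_01' (f := f) (C := ‖b - c‖)
    (fun t _ => (hd t).hasDerivWithinAt) (fun t _ => by
      calc _ ≤ _ := norm_mul₃_le
        _ ≤ 1 * ‖b - c‖ * 1 := by
          gcongr
          · exact hu t hb
          · rw [norm_smul]; simp
          · exact hu (1 - t) hc
        _ = _ := by ring)
  simpa [f, expI] using h

open scoped Matrix.Norms.L2Operator Real in
lemma exists_expI_eq {k : ℕ} {U : Matrix (Fin k) (Fin k) ℂ} (hU : U ∈ unitary _) :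
    ∃ H : Matrix (Fin k) (Fin k) ℂ, IsSelfAdjoint H ∧ ‖H‖ ≤ π ∧ expI H = U := by
  refine ⟨Unitary.argSelfAdjoint ⟨U, hU⟩, (Unitary.argSelfAdjoint ⟨U, hU⟩).2,
    Unitary.norm_argSelfAdjoint_le_pi (⟨U, hU⟩ : unitary (Matrix (Fin k) (Fin k) ℂ)), ?_⟩
  -- On a finite spectrum every function is continuous, so the branch cut of `arg` does no harm.
  have hfin : (spectrum ℂ U).Finite := Matrix.finite_spectrum U
  have hcont : ∀ g : ℂ → ℂ, ContinuousOn g (spectrum ℂ U) := fun g => hfin.continuousOn g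
  have hn : IsStarNormal U := isStarNormal_of_mem_unitary hU
  have harg : ContinuousOn (fun z => (arg z : ℂ)) (spectrum ℂ U) := hcont _
  rw [expI, Unitary.argSelfAdjoint_coe, ← CFC.exp_eq_normedSpace_exp (𝕜 := ℂ),
    ← cfc_comp_smul .., ← cfc_comp' ..]
  conv_rhs => rw [← cfc_id' ℂ U]
  refine cfc_congr fun y hy => ?_
  have hy₁ : ‖y‖ = 1 := spectrum.norm_eq_one_of_unitary hU hy
  have hy0 : y ≠ 0 := fun h => by simp [h] at hy₁
  have : I * y.arg = log y := Complex.ext (by simp [log_re, hy₁]) (by simp [log_im])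
  simpa [← exp_eq_exp_ℂ, this] using exp_log hy0

end SelfAdjoint

/-! ### Covering block diagonalizable tuples -/

section Counting

open scoped Matrix.Norms.L2Operator Real
open Matrix Module

/-- `k` is the sum of `m b` weighted by the sizes of the fibers of `β`, and those with `m b ≠ 0`
have at least `N` elements. -/
lemma mul_sum_le_of_fiber_card {I : Type*} [Fintype I] [DecidableEq I] {β : I → I} {N : ℕ}
    (hN : ∀ a, N ≤ (Finset.univ.filter fun b => β b = β a).card) {m : I → ℕ}
    (hm : ∀ b, β b ≠ b → m b = 0) {k : ℕ} (e : (Σ a, Fin (m (β a))) ≃ Fin k) :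
    N * ∑ b, m b ≤ k := by
  have hk : k = ∑ a, m (β a) := by
    have := Fintype.card_congr e
    simp only [Fintype.card_sigma, Fintype.card_fin] at this
    exact this.symm
  rw [hk, ← Finset.sum_fiberwise Finset.univ β fun a => m (β a), Finset.mul_sum]
  refine Finset.sum_le_sum fun b _ => ?_
  by_cases hb : β b = b
  · calc N * m b ≤ (Finset.univ.filter fun a => β a = b).card * m b := by
          gcongr
          have := hN b
          rwa [hb] at this
      _ = ∑ a ∈ Finset.univ.filter fun a => β a = b, m b := by simp
      _ ≤ _ := le_of_eq (Finset.sum_congr rfl fun a ha => by rw [(Finset.mem_filter.1 ha).2])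
  · simp [hm b hb]

/-- Parameters for tuples of matrices that are jointly unitarily equivalent to block diagonal
matrices. -/
abbrev BlockParameters {I : Type} [Fintype I] (m : I → ℕ) (k n : ℕ) : Type :=
  SelfAdjointSpace (Matrix (Fin k) (Fin k) ℂ) ×
    (Fin n → ∀ b, SelfAdjointSpace (Matrix (Fin (m b)) (Fin (m b)) ℂ))

variable {I : Type} [Fintype I] {m : I → ℕ} {k n : ℕ} {β : I → I}

/-- The tuple of matrices given by a choice of parameters. -/
def blockTuple (e : (Σ a, Fin (m (β a))) ≃ Fin k) (z : BlockParameters m k n) :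
    Fin n → Matrix (Fin k) (Fin k) ℂ := fun i =>
  expI (z.1 : Matrix (Fin k) (Fin k) ℂ) *
    blockSum e (fun a => (z.2 i (β a) : Matrix (Fin (m (β a))) (Fin (m (β a))) ℂ)) *
    star (expI (z.1 : Matrix (Fin k) (Fin k) ℂ))

instance (k : ℕ) : FiniteDimensional ℝ (SelfAdjointSpace (Matrix (Fin k) (Fin k) ℂ)) := by
  have : FiniteDimensional ℝ (Matrix (Fin k) (Fin k) ℂ) := FiniteDimensional.complexToReal _
  exact FiniteDimensional.finiteDimensional_submodule _

instance : FiniteDimensional ℝ (BlockParameters m k n) := by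
  have (b : I) : FiniteDimensional ℝ (SelfAdjointSpace (Matrix (Fin (m b)) (Fin (m b)) ℂ)) :=
    inferInstance
  have (_ : Fin n) : FiniteDimensional ℝ
      (∀ b, SelfAdjointSpace (Matrix (Fin (m b)) (Fin (m b)) ℂ)) := inferInstance
  exact Module.Finite.prod

lemma finrank_blockParameters_le :
    finrank ℝ (BlockParameters m k n) ≤ k ^ 2 + n * ∑ b, m b ^ 2 := by
  have h : ∀ k : ℕ, finrank ℝ (SelfAdjointSpace (Matrix (Fin k) (Fin k) ℂ)) ≤ k ^ 2 := by
    intro k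
    refine finrank_selfAdjointSpace_le.trans (le_of_eq ?_)
    rw [finrank_matrix]
    simp [sq]
  have (b : I) : FiniteDimensional ℝ (SelfAdjointSpace (Matrix (Fin (m b)) (Fin (m b)) ℂ)) :=
    inferInstance
  have (_ : Fin n) : FiniteDimensional ℝ
      (∀ b, SelfAdjointSpace (Matrix (Fin (m b)) (Fin (m b)) ℂ)) := inferInstance
  unfold BlockParameters
  rw [finrank_prod, finrank_pi_fintype]
  simp only [finrank_pi_fintype, Finset.sum_const, Finset.card_univ, Fintype.card_fin, smul_eq_mul]
  gcongr with b
  · exact h k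
  · exact h (m b)

lemma dist_blockTuple_le (e : (Σ a, Fin (m (β a))) ≃ Fin k) {z w : BlockParameters m k n} {R : ℝ}
    (hz : ‖z‖ ≤ R) (hw : ‖w‖ ≤ R) :
    dist (blockTuple e z) (blockTuple e w) ≤
      (2 * (Fintype.card I * R) + Fintype.card I) * dist z w := by
  have hR : 0 ≤ R := (norm_nonneg _).trans hz
  rw [dist_pi_le_iff (by positivity)]
  intro i
  rw [dist_eq_norm, dist_eq_norm]
  set u := expI (z.1 : Matrix (Fin k) (Fin k) ℂ) with hu
  set u' := expI (w.1 : Matrix (Fin k) (Fin k) ℂ) with hu'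
  set T := blockSum e (fun a => (z.2 i (β a) : Matrix (Fin (m (β a))) (Fin (m (β a))) ℂ)) with hT
  set T' := blockSum e (fun a => (w.2 i (β a) : Matrix (Fin (m (β a))) (Fin (m (β a))) ℂ)) with hT'
  have hcoord : ∀ (y : BlockParameters m k n) b,
      ‖(y.2 i b : Matrix (Fin (m b)) (Fin (m b)) ℂ)‖ ≤ ‖y‖ := fun y b =>
    ((norm_le_pi_norm (y.2 i) b).trans (norm_le_pi_norm y.2 i)).trans (norm_snd_le y)
  have h1 : ‖u‖ ≤ 1 := norm_le_one_of_mem_unitary (expI_mem_unitary z.1.2)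
  have h1' : ‖u'‖ ≤ 1 := norm_le_one_of_mem_unitary (expI_mem_unitary w.1.2)
  have h2 : ‖u - u'‖ ≤ ‖z - w‖ :=
    (norm_expI_sub_le z.1.2 w.1.2).trans (norm_fst_le (z - w))
  have h2' : ‖star u - star u'‖ ≤ ‖z - w‖ := by rwa [← star_sub, norm_star]
  have h3 : ‖T‖ ≤ Fintype.card I * R := norm_blockSum_le e fun a => (hcoord z (β a)).trans hz
  have h3' : ‖T'‖ ≤ Fintype.card I * R := norm_blockSum_le e fun a => (hcoord w (β a)).trans hw
  have h4 : ‖T - T'‖ ≤ Fintype.card I * ‖z - w‖ := by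
    rw [hT, hT', blockSum_sub]
    exact norm_blockSum_le e fun a => hcoord (z - w) (β a)
  have h5 : blockTuple e z i - blockTuple e w i =
      (u - u') * T * star u + u' * (T - T') * star u + u' * T' * (star u - star u') := by
    change u * T * star u - u' * T' * star u' = _
    noncomm_ring
  have hus : ‖star u‖ ≤ 1 := by rwa [norm_star]
  have g1 := norm_mul_le_of_le (norm_mul_le_of_le h2 h3) hus
  have g2 := norm_mul_le_of_le (norm_mul_le_of_le h1' h4) hus
  have g3 := norm_mul_le_of_le (norm_mul_le_of_le h1' h3') h2'
  rw [h5]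
  refine (norm_add₃_le).trans ?_
  linarith

lemma exists_blockTuple_eq (e : (Σ a, Fin (m (β a))) ≃ Fin k) {R : ℝ} (hR : 0 ≤ R)
    {U : Matrix (Fin k) (Fin k) ℂ} (hU : Uᴴ * U = 1) (hU' : U * Uᴴ = 1)
    {T : Fin n → ∀ b, Matrix (Fin (m b)) (Fin (m b)) ℂ} (hT : ∀ i b, IsSelfAdjoint (T i b))
    (hTR : ∀ i b, ‖T i b‖ ≤ R) :
    ∃ z : BlockParameters m k n, ‖z‖ ≤ R + π ∧
      ∀ i, blockTuple e z i = U * blockSum e (fun a => T i (β a)) * Uᴴ := by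
  obtain ⟨H, hH, hHn, hHU⟩ := exists_expI_eq (U := U) (Unitary.mem_iff.2 ⟨hU, hU'⟩)
  refine ⟨(⟨H, hH⟩, fun i b => ⟨T i b, hT i b⟩), ?_, fun i => ?_⟩
  · refine norm_prod_le_iff.2 ⟨hHn.trans (by linarith), ?_⟩
    refine (pi_norm_le_iff_of_nonneg (by positivity)).2 fun i => ?_
    refine (pi_norm_le_iff_of_nonneg (by positivity)).2 fun b => ?_
    exact (hTR i b).trans (by linarith [Real.pi_pos])
  · unfold blockTuple
    simp only [hHU]
    rfl

lemma exists_finset_cover_blockTuple (e : (Σ a, Fin (m (β a))) ≃ Fin k) {R ω : ℝ} (hR : 0 ≤ R)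
    (hω : 0 < ω) (hω1 : ω ≤ 1) :
    ∃ s : Finset (Fin n → Matrix (Fin k) (Fin k) ℂ),
      (∀ z : BlockParameters m k n, ‖z‖ ≤ R → ∃ c ∈ s, dist (blockTuple e z) c < ω) ∧
      (s.card : ℝ) ≤ ((1 + 2 * R * (2 * (Fintype.card I * R) + Fintype.card I + 1)) / ω) ^
        (k ^ 2 + n * ∑ b, m b ^ 2) := by
  classical
  set L : ℝ := 2 * (Fintype.card I * R) + Fintype.card I + 1 with hL
  have hL0 : 0 < L := by positivity
  obtain ⟨s, hsR, hs, hcard⟩ := exists_finset_cover_closedBall (E := BlockParameters m k n) hR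
    (div_pos hω hL0)
  refine ⟨s.image (blockTuple e), fun z hz => ?_, ?_⟩
  · obtain ⟨c, hc, hzc⟩ := hs z hz
    refine ⟨_, Finset.mem_image_of_mem _ hc, (dist_blockTuple_le e hz (hsR c hc)).trans_lt ?_⟩
    calc _ ≤ L * dist z c := by gcongr; rw [hL]; linarith
      _ < L * (ω / L) := by gcongr
      _ = ω := by field_simp
  · have h1 : 1 + 2 * R / (ω / L) ≤ (1 + 2 * R * L) / ω := by
      rw [le_div_iff₀ hω]
      have : (1 + 2 * R / (ω / L)) * ω = ω + 2 * R * L := by field_simp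
      linarith
    have h2 : 1 ≤ 1 + 2 * R / (ω / L) := by
      have : 0 ≤ 2 * R / (ω / L) := by positivity
      linarith
    calc ((s.image (blockTuple e)).card : ℝ) ≤ s.card := by exact_mod_cast Finset.card_image_le
      _ ≤ _ := hcard
      _ ≤ (1 + 2 * R / (ω / L)) ^ (k ^ 2 + n * ∑ b, m b ^ 2) :=
        pow_le_pow_right₀ h2 finrank_blockParameters_le
      _ ≤ _ := pow_le_pow_left₀ (by linarith) h1 _

end Counting

/-! ### The dimension estimate -/

section Dimension

open scoped Matrix.Norms.L2Operator Real
open Matrix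

variable {A : Type*} [CStarAlgebra A] {n : ℕ} {p : ℕ → FreeAlgebra ℂ (Fin n)} {x : Fin n → A}

/-- The net is a union over all block sizes `m : I → Fin (k + 1)`. `c` and `K` come before `ω`, as
the limit `ω → 0` requires; `K` contains a factor 2 because half of `ω` is spent on the block
approximation and half on the net. -/
lemma IsApproximatelyDivisible.exists_nuTop_le (hA : IsApproximatelyDivisible A)
    (hx : ∀ i, IsSelfAdjoint (x i)) (hgen : Generates x) (hp : IsRationalEnumeration p) (s : ℕ) :
    ∃ (c : ℕ) (K : ℝ), 1 ≤ K ∧ ∀ ω : ℝ, 0 < ω → ω < 1 → ∃ ε > 0, ∃ m, ∀ k : ℕ,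
      (nuTop p x k ε m ω : ENNReal) ≤ ENNReal.ofReal
        (((k : ℝ) + 1) ^ c * (K / ω) ^ ((k : ℝ) ^ 2 * (1 + n / (2 ^ s) ^ 2))) := by
  obtain ⟨I, _, _, β, hβ, hN, hv⟩ := hA.exists_isApproxColumnSystem s
  set R : ℝ := ‖x‖ + 1 with hR
  have hR0 : 0 ≤ R := by positivity
  set R' : ℝ := R + π with hR'
  have hR'0 : 0 ≤ R' := by positivity
  set K : ℝ := 2 * (1 + 2 * R' * (2 * (Fintype.card I * R') + Fintype.card I + 1)) with hK
  have hK1 : 1 ≤ K := by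
    have : 0 ≤ 2 * R' * (2 * (Fintype.card I * R') + Fintype.card I + 1) := by positivity
    linarith
  refine ⟨Fintype.card I, K, hK1, fun ω hω hω1 => ?_⟩
  have hω2 : 0 < ω / 2 := by positivity
  obtain ⟨δ, hδ, hblock⟩ := exists_blockSum_near hβ hR0 hω2
  obtain ⟨v, hv1, hv2⟩ := hv n x δ hδ
  obtain ⟨ε, hε, M, hM⟩ := hp.exists_columnSystem hx hgen hv1 hv2
  refine ⟨ε, hε, M, fun k => ?_⟩
  set Q : ℝ := (K / ω) ^ ((k : ℝ) ^ 2 * (1 + n / (2 ^ s) ^ 2)) with hQ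
  have hKω : 1 ≤ K / ω := by rw [le_div_iff₀ hω]; linarith
  have hQ0 : 0 ≤ Q := by positivity
  have hmsum : ∀ m : I → ℕ, 2 ^ s * ∑ b, m b ≤ k →
      ((k ^ 2 + n * ∑ b, m b ^ 2 : ℕ) : ℝ) ≤ (k : ℝ) ^ 2 * (1 + n / (2 ^ s) ^ 2) := by
    intro m hm
    have h1 : ∑ b, (m b : ℝ) ^ 2 ≤ (∑ b, (m b : ℝ)) ^ 2 :=
      Finset.sum_sq_le_sq_sum_of_nonneg fun b _ => by positivity
    have h2 : (2 : ℝ) ^ s * ∑ b, (m b : ℝ) ≤ k := by exact_mod_cast hm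
    have h3 : ((2 : ℝ) ^ s * ∑ b, (m b : ℝ)) ^ 2 ≤ (k : ℝ) ^ 2 := by gcongr
    have h4 : ∑ b, (m b : ℝ) ^ 2 ≤ (k : ℝ) ^ 2 / (2 ^ s) ^ 2 := by
      rw [le_div_iff₀ (by positivity)]
      nlinarith [sq_nonneg ((2 : ℝ) ^ s)]
    push_cast
    calc (k : ℝ) ^ 2 + n * ∑ b, (m b : ℝ) ^ 2 ≤ (k : ℝ) ^ 2 + n * ((k : ℝ) ^ 2 / (2 ^ s) ^ 2) := by
          gcongr
      _ = _ := by ring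
  -- One identification `e` is fixed per `m`, so microstates with equal block sizes share a net;
  -- `e₀` only certifies that one exists.
  have hcover : ∀ m : I → Fin (k + 1), ∃ C : Finset (Fin n → Matrix (Fin k) (Fin k) ℂ),
      (C.card : ℝ) ≤ Q ∧ ((2 ^ s * ∑ b, (m b : ℕ) ≤ k) →
        ∀ e₀ : (Σ a, Fin (m (β a))) ≃ Fin k, ∃ e : (Σ a, Fin (m (β a))) ≃ Fin k,
        ∀ z : BlockParameters (fun b => (m b : ℕ)) k n, ‖z‖ ≤ R' →
          ∃ c ∈ C, dist (blockTuple (β := β) e z) c < ω / 2) := by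
    intro m
    by_cases hm : 2 ^ s * ∑ b, (m b : ℕ) ≤ k ∧ Nonempty ((Σ a, Fin (m (β a))) ≃ Fin k)
    · obtain ⟨hm1, ⟨e⟩⟩ := hm
      obtain ⟨C, hC, hcard⟩ := exists_finset_cover_blockTuple (n := n) (m := fun b => (m b : ℕ))
        (β := β) e hR'0 hω2 (by linarith)
      refine ⟨C, hcard.trans ?_, fun _ _ => ⟨e, hC⟩⟩
      have : (1 + 2 * R' * (2 * (Fintype.card I * R') + Fintype.card I + 1)) / (ω / 2) = K / ω := by
        rw [hK]; field_simp
      rw [this, ← Real.rpow_natCast]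
      exact Real.rpow_le_rpow_of_exponent_le hKω (hmsum _ hm1)
    · exact ⟨∅, by simpa using hQ0, fun h1 e => absurd ⟨h1, ⟨e⟩⟩ hm⟩
  classical
  choose C hCcard hC using hcover
  have hsub : gammaTop p x k ε M ⊆
      ⋃ c ∈ ((Finset.univ.biUnion C : Finset (Fin n → Matrix (Fin k) (Fin k) ℂ)) : Set _),
        Metric.ball c ω := by
    intro a ha
    obtain ⟨haR, w, hw, hwa⟩ := hM k a ha
    obtain ⟨m, hm, ⟨e₀⟩, hU⟩ := hblock hw
    have hmk := mul_sum_le_of_fiber_card hN hm e₀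
    have hmlt : ∀ b, m b < k + 1 := fun b => by
      have h1 : m b ≤ ∑ b, m b := Finset.single_le_sum (fun _ _ => Nat.zero_le _)
        (Finset.mem_univ b)
      have h2 := Nat.one_le_two_pow (n := s)
      nlinarith
    obtain ⟨e, he⟩ := hC (fun b => ⟨m b, hmlt b⟩) hmk e₀
    obtain ⟨U, hU1, hU2, hU⟩ := hU e
    choose T hT1 hT2 hT3 using fun i => hU (a i) (ha.1 i)
      ((haR i).trans (by rw [hR]; linarith [norm_le_pi_norm x i])) (hwa i)
    obtain ⟨z, hz, hzU⟩ := exists_blockTuple_eq e hR0 hU1 hU2 hT1 hT2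
    obtain ⟨c, hc, hzc⟩ := he z hz
    simp only [Set.mem_iUnion, Metric.mem_ball]
    refine ⟨c, Finset.mem_biUnion.2 ⟨_, Finset.mem_univ _, hc⟩, ?_⟩
    have h1 : dist a (blockTuple e z) ≤ ω / 2 := by
      rw [dist_pi_le_iff hω2.le]
      intro i
      rw [dist_eq_norm, hzU]
      exact hT3 i
    linarith [dist_triangle a (blockTuple e z) c]
  have hν : nuTop p x k ε M ω ≤ ((Finset.univ.biUnion C).card : ℕ∞) := by
    have := iInf₂_le (f := fun (C : Set (Fin n → Matrix (Fin k) (Fin k) ℂ))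
      (_ : gammaTop p x k ε M ⊆ ⋃ c ∈ C, Metric.ball c ω) => C.encard) _ hsub
    rwa [Set.encard_coe_eq_coe_finsetCard] at this
  have hcard : ((Finset.univ.biUnion C).card : ℝ) ≤ ((k : ℝ) + 1) ^ Fintype.card I * Q := by
    calc ((Finset.univ.biUnion C).card : ℝ) ≤ ∑ m, ((C m).card : ℝ) := by
          exact_mod_cast Finset.card_biUnion_le
      _ ≤ ∑ _m : I → Fin (k + 1), Q := Finset.sum_le_sum fun m _ => hCcard m
      _ = _ := by simp
  calc (nuTop p x k ε M ω : ENNReal) ≤ (((Finset.univ.biUnion C).card : ℕ∞) : ENNReal) := by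
        exact_mod_cast hν
    _ = ENNReal.ofReal ((Finset.univ.biUnion C).card : ℝ) := by simp
    _ ≤ _ := ENNReal.ofReal_le_ofReal hcard

/-- After division by `k ^ 2` the logarithm of the polynomial factor tends to 0, leaving only the
exponential one. -/
lemma IsApproximatelyDivisible.exists_deltaTopAt_le (hA : IsApproximatelyDivisible A)
    (hx : ∀ i, IsSelfAdjoint (x i)) (hgen : Generates x) (hp : IsRationalEnumeration p) (s : ℕ) :
    ∃ K : ℝ, 1 ≤ K ∧ ∀ ω : ℝ, 0 < ω → ω < 1 → deltaTopAt p x ω ≤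
      (((1 + n / (2 ^ s) ^ 2) * ((Real.log K - Real.log ω) / -Real.log ω) : ℝ) : EReal) := by
  obtain ⟨c, K, hK, h⟩ := hA.exists_nuTop_le hx hgen hp s
  refine ⟨K, hK, fun ω hω hω1 => ?_⟩
  obtain ⟨ε, hε, M, hν⟩ := h ω hω hω1
  set α : ℝ := 1 + n / (2 ^ s) ^ 2 with hα
  have hlog : 0 < -Real.log ω := by linarith [Real.log_neg hω hω1]
  have hbound : ∀ᶠ k : ℕ in atTop, ENNReal.log (nuTop p x k ε M ω : ENNReal) /
      ((-((k : ℝ) ^ 2 * Real.log ω) : ℝ) : EReal) ≤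
      ((c * (Real.log ((k : ℝ) + 1) / (k : ℝ) ^ 2) / -Real.log ω +
        α * ((Real.log K - Real.log ω) / -Real.log ω) : ℝ) : EReal) := by
    filter_upwards [eventually_ge_atTop 1] with k hk
    have hk0 : (0 : ℝ) < k := by exact_mod_cast hk
    have hKω : 0 < K / ω := by positivity
    have h1 : 0 < ((k : ℝ) + 1) ^ c * (K / ω) ^ ((k : ℝ) ^ 2 * α) := by positivity
    have h2 := ENNReal.log_le_log (hν k)
    rw [ENNReal.log_ofReal_of_pos h1, Real.log_mul (by positivity) (by positivity), Real.log_pow,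
      Real.log_rpow hKω, Real.log_div (by positivity) hω.ne'] at h2
    have hden : 0 < -((k : ℝ) ^ 2 * Real.log ω) := by
      rw [← mul_neg]; positivity
    refine (EReal.div_le_div_right_of_nonneg (EReal.coe_nonneg.2 hden.le) h2).trans
      (le_of_eq ?_)
    rw [← EReal.coe_div]
    congr 1
    have := hlog.ne'
    have : Real.log ω ≠ 0 := by linarith
    field_simp
    ring
  have hlim : Tendsto (fun k : ℕ => c * (Real.log ((k : ℝ) + 1) / (k : ℝ) ^ 2) / -Real.log ω +
      α * ((Real.log K - Real.log ω) / -Real.log ω)) atTop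
      (𝓝 (α * ((Real.log K - Real.log ω) / -Real.log ω))) := by
    have h0 : Tendsto (fun k : ℕ => Real.log ((k : ℝ) + 1) / (k : ℝ) ^ 2) atTop (𝓝 0) := by
      refine squeeze_zero' (g := fun k : ℕ => (1 : ℝ) / k) ?_ ?_ tendsto_one_div_atTop_nhds_zero_nat
      · filter_upwards with k
        exact div_nonneg (Real.log_nonneg (by linarith [Nat.cast_nonneg (α := ℝ) k])) (by positivity)
      · filter_upwards [eventually_ge_atTop 1] with k hk
        have hk0 : (0 : ℝ) < k := by exact_mod_cast hk
        have := Real.log_le_sub_one_of_pos (show 0 < (k : ℝ) + 1 by positivity)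
        rw [div_le_div_iff₀ (by positivity) hk0]
        nlinarith
    simpa using ((h0.const_mul (c : ℝ)).div_const (-Real.log ω)).add_const
      (α * ((Real.log K - Real.log ω) / -Real.log ω))
  have hlim' := (continuous_coe_real_ereal.tendsto _).comp hlim
  calc deltaTopAt p x ω ≤ _ := iInf₂_le_of_le ε hε (iInf_le _ M)
    _ ≤ _ := limsup_le_limsup hbound
    _ = _ := hlim'.limsup_eq

lemma IsApproximatelyDivisible.deltaTop_le (hA : IsApproximatelyDivisible A)
    (hx : ∀ i, IsSelfAdjoint (x i)) (hgen : Generates x) (hp : IsRationalEnumeration p) (s : ℕ) :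
    deltaTop p x ≤ ((1 + n / (2 ^ s) ^ 2 : ℝ) : EReal) := by
  obtain ⟨K, hK, h⟩ := hA.exists_deltaTopAt_le hx hgen hp s
  have hlim : Tendsto (fun ω : ℝ =>
      (1 + n / (2 ^ s) ^ 2) * ((Real.log K - Real.log ω) / -Real.log ω)) (𝓝[>] 0)
      (𝓝 (1 + (n : ℝ) / (2 ^ s) ^ 2)) := by
    have h1 : Tendsto (fun ω : ℝ => -Real.log ω) (𝓝[>] 0) atTop :=
      tendsto_neg_atBot_atTop.comp Real.tendsto_log_nhdsGT_zero
    have h2 : Tendsto (fun ω : ℝ => (Real.log K - Real.log ω) / -Real.log ω) (𝓝[>] 0) (𝓝 1) := by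
      have h3 : Tendsto (fun ω : ℝ => Real.log K / -Real.log ω + 1) (𝓝[>] 0) (𝓝 (0 + 1)) :=
        (h1.const_div_atTop (Real.log K)).add_const 1
      rw [zero_add] at h3
      refine h3.congr' ?_
      filter_upwards [h1.eventually_gt_atTop 0] with ω hω
      rw [sub_eq_add_neg, add_div, div_self hω.ne']
    simpa using h2.const_mul (1 + (n : ℝ) / (2 ^ s) ^ 2)
  have hlim' := (continuous_coe_real_ereal.tendsto _).comp hlim
  calc deltaTop p x ≤ _ := limsup_le_limsup (by
        filter_upwards [Ioo_mem_nhdsGT (zero_lt_one (α := ℝ))] with ω hω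
        exact h ω hω.1 hω.2)
    _ = _ := hlim'.limsup_eq

end Dimension

end TopFreeEntropy

end

theorem theorem4p1 {A : Type*} [CStarAlgebra A] [TopologicalSpace.SeparableSpace A]
    (hA : TopFreeEntropy.IsApproximatelyDivisible A)
    {n : ℕ} (x : Fin n → A) (hx : ∀ i, IsSelfAdjoint (x i))
    (hgen : TopFreeEntropy.Generates x)
    (p : ℕ → FreeAlgebra ℂ (Fin n)) (hp : TopFreeEntropy.IsRationalEnumeration p) :
    TopFreeEntropy.deltaTop p x ≤ 1 := by
  have hlim : Tendsto (fun s : ℕ => (1 + n / (2 ^ s) ^ 2 : ℝ)) atTop (𝓝 1) := by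
    have h1 : Tendsto (fun s : ℕ => ((2 : ℝ) ^ s) ^ 2) atTop atTop :=
      (tendsto_pow_atTop two_ne_zero).comp (tendsto_pow_atTop_atTop_of_one_lt one_lt_two)
    simpa using (h1.const_div_atTop (n : ℝ)).const_add 1
  -- The block contribution `n / (2 ^ s) ^ 2` vanishes as `s → ∞`.
  exact ge_of_tendsto' ((continuous_coe_real_ereal.tendsto _).comp hlim)
    fun s => hA.deltaTop_le hx hgen hp s
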